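/- **Setting.** Let $H=(H_{mn})_{m,n\ge1}$ and $K=(K_{nm})_{n,m\ge1}$ be real semi-infinite matrices and consider the semi-infinite Toda theory $$u_{n,xy}=F_n,\qquad F_n=\sum_{m\ge1}K_{nm}\exp\Big(\sum_{l\ge1}H_{ml}u_l\Big),\qquad n\ge1 .$$ Let $M,N,M',N'\ge0$ and $p_1,p_2,q_1,q_2\in\mathbb Z$ satisfy $0\le M+p_1\le N\le M+p_2$ and $0\le N'+q_1\le M'\le N'+q_2$. Assume that the first $M$ rows of $H$ vanish outside the first $N$ columns, and that for $n>M$ one has $H_{n,n+\sigma}=0$ unless $p_1\le\sigma\le p_2$, with $H_{n,n+p_1}\ne0\ne H_{n,n+p_2}$. Assume that the first $N'$ columns of $K$ vanish outside the first $M'$ rows, and that for $m>N'$ one has $K_{m+\sigma,m}=0$ unless $q_1\le\sigma\le q_2$, with $K_{m+q_1,m}\neq0\ne K_{m+q_2,m}$. Let $\tilde H$ ($M\times N$) and $\tilde K$ ($M'\times N'$) be the upper left corner blocks. Assume that the rows of $H$ are pairwise different and nonzero, and that $HK$ has no zero column. Put $$n_0=M-N+p_2+\dim\ker\tilde H,\qquad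 m_0=N'-M'+q_2+\dim\ker\tilde K^{T}.$$ A vector field $v=\xi\,\partial_x+\eta\,\partial_y+\sum_n\phi_n\,\partial_{u_n}$, with smooth coefficients depending on $(x,y,\{u_k\})$ (on all of $\mathbb R^2$ in $x,y$; formal infinite linear combinations $\sum_k a_ku_k$ are allowed), is a *symmetry* if its second prolongation satisfies $\mathrm{pr}^{(2)}v\,(u_{n,xy}-F_n)=0$ for all $n$ when $u_{k,xy}=F_k$ for all $k$; infinite sums over $k$ arising here are summed as series in the exponentials $\exp(\sum_lH_{ml}u_l)$, $m=1,2,\dots$. The theory is *conformally invariant* if for all smooth functions $\xi(x)$, $\eta(y)$ there is a symmetry whose $\partial_x$ and $\partial_y$ coefficients are $\xi$ and $\eta$. **Theorem.** 1. The theory is conformally invariant if and only if $(1,\dots,1)^T\in\operatorname{Im}\tilde H$. In this case the equation $Hb=(1,1,\dots)^T$, i.e. the finite system $\tilde H\tilde b=(1,\dots,1)^T$ for $\tilde b=(b_1,\dots,b_N)^T$ together with the difference equation $\sum_{\sigma=p_1}^{p_2}H_{n,n+\sigma}b_{n+\sigma}=1$ for $n\ge M+1$, has a solution. 2. There are a basis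 $\chi^1,\dots,\chi^{n_0}$ of $\{\chi: H\chi=0\}$ and a basis $\varphi^1,\dots,\varphi^{m_0}$ of $\{\varphi:\varphi K=0\}$ (in each case a finite system given by $\tilde H$, resp. $\tilde K^T$, together with the homogeneous difference equation for the remaining rows of $H$, resp. columns of $K$), so that these spaces have dimensions $n_0$ and $m_0$, with the following properties. Put $$U_j(r)=r(x)\sum_n\chi^j_n\partial_{u_n},\quad V_j(s)=s(y)\sum_n\chi^j_n\partial_{u_n},\quad Z_{jl}=\Big(\sum_m\varphi^l_mu_m\Big)\sum_n\chi^j_n\partial_{u_n}.$$ * If $(1,\dots,1)^T\in\operatorname{Im}\tilde H$ and $Hb=(1,1,\dots)^T$, then the symmetries are exactly the fields $$\xi(x)\partial_x-\xi'(x)\sum_nb_n\partial_{u_n}+\eta(y)\partial_y-\eta'(y)\sum_nb_n\partial_{u_n}+\sum_jU_j(r_j)+\sum_jV_j(s_j)+\sum_{j,l}q_{jl}Z_{jl}$$ with arbitrary smooth functions $\xi,\eta,r_j,s_j$ of one variable and constants $q_{jl}$. * If $(1,\dots,1)^T\notin\operatorname{Im}\tilde H$, only Poincaré transformations of $x,y$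 remain: the symmetries are exactly the fields $$a_1\partial_x+a_2\partial_y+c\,(x\partial_x-y\partial_y)+\sum_jU_j(r_j)+\sum_jV_j(s_j)+\sum_{j,l}q_{jl}Z_{jl}$$ with constants $a_1,a_2,c,q_{jl}$ and arbitrary smooth functions $r_j,s_j$. * Hence, if $n_0>0$, there are $2n_0$ gauge generators $U_j(r_j)$, $V_j(s_j)$, involving $2n_0$ arbitrary functions of one variable; these are independent up to constants: $\sum_jU_j(r_j)+\sum_jV_j(s_j)=0$ if and only if, for every $j$, $r_j$ is a constant $c_j$ and $s_j=-c_j$. * The symmetries of the form $\sum_n\big(\sum_mA_{nm}u_m\big)\partial_{u_n}$ with a constant matrix $A$ ($Z$-type symmetries) form a vector space with basis $Z_{jl}$, hence of dimension $m_0n_0$ (so they exist if $n_0>0$ and $m_0>0$). This space is closed under the Lie bracket of vector fields, whenever the series over the fields that defines the bracket converges. If $g=\sum_m\varphi^d_m\chi^a_m$ and $h=\sum_m\varphi^b_m\chi^c_m$ converge, then $[Z_{ab},Z_{cd}]=g\,Z_{cb}-h\,Z_{ad}$. -/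

import Mathlib

open scoped ContDiff
open Filter Topology

noncomputable section

namespace Toda

/-! Fields are numbered from `0` (so index `i` here is the field number `i + 1` in the usual
numbering `n = 1, 2, …`); the offsets `σ` in `H i (i + σ)` and `K (j + σ) j` do not depend on this
shift. -/

/-- The upper left `a × b` corner block of a semi-infinite matrix. -/
def corner (A : ℕ → ℕ → ℝ) (a b : ℕ) : Matrix (Fin a) (Fin b) ℝ :=
  Matrix.of fun i j => A i j

/-- The semi-infinite matrix `H`: the first `M` rows are an `M × N` corner block, and each later
row `i` is supported on the columns `i + p₁, …, i + p₂`, with nonzero entries at both ends. -/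
structure IsSemiBandRows (M N : ℕ) (p₁ p₂ : ℤ) (H : ℕ → ℕ → ℝ) : Prop where
  start_nonneg : 0 ≤ (M : ℤ) + p₁
  le_corner : (M : ℤ) + p₁ ≤ N
  corner_le : (N : ℤ) ≤ M + p₂
  corner_zero : ∀ i j : ℕ, i < M → N ≤ j → H i j = 0
  band_zero : ∀ i j : ℕ, M ≤ i → ((j : ℤ) < i + p₁ ∨ (i : ℤ) + p₂ < j) → H i j = 0
  left_ne_zero : ∀ i j : ℕ, M ≤ i → (j : ℤ) = i + p₁ → H i j ≠ 0
  right_ne_zero : ∀ i j : ℕ, M ≤ i → (j : ℤ) = i + p₂ → H i j ≠ 0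

/-- The semi-infinite matrix `K`: the first `N'` columns are an `M' × N'` corner block, and each
later column `j` is supported on the rows `j + q₁, …, j + q₂`, with nonzero entries at both
ends. -/
def IsSemiBandColumns (M' N' : ℕ) (q₁ q₂ : ℤ) (K : ℕ → ℕ → ℝ) : Prop :=
  IsSemiBandRows N' M' q₁ q₂ (fun j i => K i j)

/-- `B` solves `H B = (c, c, …)`: the finite system given by the corner block, and the linear
difference equation `∑ σ, h_σ(i) B_{i+σ} = c` for all later rows `i`. -/
def IsRightSolution (M N : ℕ) (p₁ p₂ : ℤ) (H : ℕ → ℕ → ℝ) (c : ℝ) (B : ℕ → ℝ) : Prop :=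
  (corner H M N).mulVec (fun j => B j) = (fun _ => c) ∧
    ∀ i : ℕ, M ≤ i →
      ∑ σ ∈ Finset.Icc p₁ p₂, H i ((i : ℤ) + σ).toNat * B ((i : ℤ) + σ).toNat = c

/-- `φ` solves `φ K = 0`: the finite system given by the transposed corner block, and the linear
difference equation `∑ σ, k_σ(j) φ_{j+σ} = 0` for all later columns `j`. -/
def IsLeftSolution (M' N' : ℕ) (q₁ q₂ : ℤ) (K : ℕ → ℕ → ℝ) (φ : ℕ → ℝ) : Prop :=
  (corner K M' N').transpose.mulVec (fun i => φ i) = 0 ∧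
    ∀ j : ℕ, N' ≤ j →
      ∑ σ ∈ Finset.Icc q₁ q₂, K ((j : ℤ) + σ).toNat j * φ ((j : ℤ) + σ).toNat = 0

/-- `n₀ = M - N + p₂ + dim ker H̃`. -/
def gaugeNumber (M N : ℕ) (p₂ : ℤ) (H : ℕ → ℕ → ℝ) : ℤ :=
  (M : ℤ) - N + p₂ + Module.finrank ℝ (LinearMap.ker (corner H M N).mulVecLin)

/-- `m₀ = N' - M' + q₂ + dim ker K̃ᵀ`. -/
def leftNumber (M' N' : ℕ) (q₂ : ℤ) (K : ℕ → ℕ → ℝ) : ℤ :=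
  (N' : ℤ) - M' + q₂ +
    Module.finrank ℝ (LinearMap.ker (corner K M' N').transpose.mulVecLin)

/-! ### Functions of `x, y, {u_k}` and vector fields -/

/-- Functions of `(x, y, {u_k})`. They are evaluated at field values `u` with finitely many
nonzero components; there every formal infinite linear combination `∑ a_k u_k` has a value. -/
abbrev Coef : Type := ℝ → ℝ → (ℕ →₀ ℝ) → ℝ

/-- Smoothness: the function is `C^∞` in `x, y, u_0, …, u_{n-1}`, for every `n`. -/
def SmoothCoef (f : Coef) : Prop :=
  ∀ n : ℕ, ContDiff ℝ ∞ (fun p : ℝ × ℝ × (Fin n → ℝ) =>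
    f p.1 p.2.1 (∑ i : Fin n, Finsupp.single (i : ℕ) (p.2.2 i)))

/-- `∂f/∂x`. -/
def dx (f : Coef) : Coef := fun x y u => deriv (fun t => f t y u) x

/-- `∂f/∂y`. -/
def dy (f : Coef) : Coef := fun x y u => deriv (fun t => f x t u) y

/-- `∂f/∂u_k`. -/
def du (k : ℕ) (f : Coef) : Coef := fun x y u => deriv (fun t => f x y (u + Finsupp.single k t)) 0

/-- Vector fields `ξ ∂_x + η ∂_y + ∑ φ_n ∂_{u_n}`, as triples `(ξ, η, φ)` whose entries depend
on `(x, y, {u_k})`. -/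
abbrev VectorField : Type := Coef × Coef × (ℕ → Coef)

/-- The coefficient of `∂_x`. -/
abbrev VectorField.xi (v : VectorField) : Coef := v.1

/-- The coefficient of `∂_y`. -/
abbrev VectorField.eta (v : VectorField) : Coef := v.2.1

/-- The coefficients of the `∂_{u_n}`. -/
abbrev VectorField.phi (v : VectorField) : ℕ → Coef := v.2.2

/-- All coefficients are smooth. -/
def VectorField.Smooth (v : VectorField) : Prop :=
  SmoothCoef v.xi ∧ SmoothCoef v.eta ∧ ∀ n, SmoothCoef (v.phi n)

/-! ### Second order jets and prolongation -/

/-- Points of the second order jet space: the independent variables, the fields, and the values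
of their first and second derivatives. -/
structure Jet where
  x : ℝ
  y : ℝ
  u : ℕ →₀ ℝ
  ux : ℕ →₀ ℝ
  uy : ℕ →₀ ℝ
  uxx : ℕ →₀ ℝ
  uxy : ℕ → ℝ
  uyy : ℕ →₀ ℝ

/-- The total derivative `D_x f = f_x + ∑ u_{k,x} f_{u_k}`. -/
def totalX (f : Coef) (j : Jet) : ℝ :=
  dx f j.x j.y j.u + j.ux.sum fun k a => a * du k f j.x j.y j.u

/-- The total derivative `D_y f = f_y + ∑ u_{k,y} f_{u_k}`. -/
def totalY (f : Coef) (j : Jet) : ℝ :=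
  dy f j.x j.y j.u + j.uy.sum fun k a => a * du k f j.x j.y j.u

/-- The total derivative `D_x D_y f`. -/
def totalXY (f : Coef) (j : Jet) : ℝ :=
  dx (dy f) j.x j.y j.u
    + (j.uy.sum fun k a => a * dx (du k f) j.x j.y j.u)
    + (j.ux.sum fun k a => a * dy (du k f) j.x j.y j.u)
    + (j.ux.sum fun k a => j.uy.sum fun l b => a * b * du k (du l f) j.x j.y j.u)
    + ∑ᶠ k : ℕ, j.uxy k * du k f j.x j.y j.u

/-- The coefficient of `∂_{u_{n,xy}}` in the second prolongation of `v`. -/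
def prolongXY (v : VectorField) (n : ℕ) (j : Jet) : ℝ :=
  totalXY (v.phi n) j
    - totalXY v.xi j * j.ux n - totalXY v.eta j * j.uy n
    - totalY v.xi j * j.uxx n - totalX v.eta j * j.uyy n
    - (totalX v.xi j + totalY v.eta j) * j.uxy n

/-- The exponential `exp (∑ l, H m l * u l)`. -/
def expTerm (H : ℕ → ℕ → ℝ) (m : ℕ) (u : ℕ →₀ ℝ) : ℝ :=
  Real.exp (u.sum fun l a => H m l * a)

/-- The right hand side `F_n = ∑ m, K n m * exp (∑ l, H m l * u l)` of the field equations. The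
sum over `m` has finitely many nonzero terms when `K` is as in `IsSemiBandColumns`. -/
def interaction (H K : ℕ → ℕ → ℝ) (n : ℕ) : Coef :=
  fun _ _ u => ∑ᶠ m : ℕ, K n m * expTerm H m u

/-- The part of `F_n` that comes from the first `L` exponentials. For fixed `n` it equals `F_n`
as soon as `L` is large; for fixed `L` it is nonzero for finitely many `n` only. -/
def cutInteraction (H K : ℕ → ℕ → ℝ) (L : ℕ) (u : ℕ →₀ ℝ) (n : ℕ) : ℝ :=
  ∑ m ∈ Finset.range L, K n m * expTerm H m u

/-- `pr⁽²⁾ v` applied to `E_n = u_{n,xy} - F_n`. -/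
def prolongE (H K : ℕ → ℕ → ℝ) (v : VectorField) (n : ℕ) (j : Jet) : ℝ :=
  prolongXY v n j
    - (v.xi j.x j.y j.u * dx (interaction H K n) j.x j.y j.u
      + v.eta j.x j.y j.u * dy (interaction H K n) j.x j.y j.u
      + ∑ᶠ k : ℕ, v.phi k j.x j.y j.u * du k (interaction H K n) j.x j.y j.u)

/-- `v` is an (infinitesimal) Lie point symmetry of `u_{n,xy} = F_n`, `n ∈ ℕ`: it is smooth and
`pr⁽²⁾ v (E_n) = 0` on the equation manifold `u_{k,xy} = F_k`. The infinite sums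
`∑ k, f_{u_k} u_{k,xy}` that arise on this manifold when coefficients of `v` depend on infinitely
many fields are series in the exponentials `exp (∑ l, H m l * u l)`, and are summed as such. When
the coefficients depend on finitely many fields the limit is over an eventually constant
sequence. -/
def IsSymmetry (H K : ℕ → ℕ → ℝ) (v : VectorField) : Prop :=
  v.Smooth ∧ ∀ (n : ℕ) (x y : ℝ) (u ux uy uxx uyy : ℕ →₀ ℝ),
    Tendsto (fun L : ℕ => prolongE H K v n
      { x := x, y := y, u := u, ux := ux, uy := uy, uxx := uxx,
        uxy := cutInteraction H K L u, uyy := uyy }) atTop (𝓝 0)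

/-- The theory is conformally invariant: arbitrary infinitesimal reparametrizations
`ξ(x) ∂_x + η(y) ∂_y`, accompanied by suitable transformations of the fields, are symmetries. -/
def ConformallyInvariant (H K : ℕ → ℕ → ℝ) : Prop :=
  ∀ ξ η : ℝ → ℝ, ContDiff ℝ ∞ ξ → ContDiff ℝ ∞ η →
    ∃ v : VectorField, IsSymmetry H K v ∧
      v.xi = (fun x _ _ => ξ x) ∧ v.eta = (fun _ y _ => η y)

/-! ### The generators -/

/-- `X(ξ) = ξ(x) ∂_x - ξ'(x) ∑ b_n ∂_{u_n}`. -/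
def genX (b : ℕ → ℝ) (ξ : ℝ → ℝ) : VectorField :=
  (fun x _ _ => ξ x, 0, fun n x _ _ => -(deriv ξ x * b n))

/-- `Y(η) = η(y) ∂_y - η'(y) ∑ b_n ∂_{u_n}`. -/
def genY (b : ℕ → ℝ) (η : ℝ → ℝ) : VectorField :=
  (0, fun _ y _ => η y, fun n _ y _ => -(deriv η y * b n))

/-- `U(r) = r(x) ∑ χ_n ∂_{u_n}`. -/
def genU (χ : ℕ → ℝ) (r : ℝ → ℝ) : VectorField :=
  (0, 0, fun n x _ _ => r x * χ n)

/-- `V(s) = s(y) ∑ χ_n ∂_{u_n}`. -/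
def genV (χ : ℕ → ℝ) (s : ℝ → ℝ) : VectorField :=
  (0, 0, fun n _ y _ => s y * χ n)

/-- `Z = (∑ φ_m u_m) (∑ χ_n ∂_{u_n})`. -/
def genZ (χ φ : ℕ → ℝ) : VectorField :=
  (0, 0, fun n _ _ u => (u.sum fun m a => φ m * a) * χ n)

/-- `P₁ = ∂_x`. -/
def genP₁ : VectorField := (fun _ _ _ => 1, 0, 0)

/-- `P₂ = ∂_y`. -/
def genP₂ : VectorField := (0, fun _ _ _ => 1, 0)

/-- `L = x ∂_x - y ∂_y`. -/
def genL : VectorField := (fun x _ _ => x, fun _ y _ => -y, 0)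

/-- `v` is a linear transformation `∑ n, (∑ m, A n m * u m) ∂_{u_n}` of the fields. -/
def IsLinearField (v : VectorField) : Prop :=
  ∃ A : ℕ → ℕ → ℝ, v = (0, 0, fun n _ _ u => u.sum fun m a => A n m * a)

/-- `ξ f_x + η f_y + ∑ φ_k f_{u_k}`, the sum over the first `L` fields. -/
def cutAction (L : ℕ) (v : VectorField) (f : Coef) : Coef := fun x y u =>
  v.xi x y u * dx f x y u + v.eta x y u * dy f x y u
    + ∑ k ∈ Finset.range L, v.phi k x y u * du k f x y u

/-- `c = [v, w]`: the series over the fields that define the components of the commutator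
converge, with sums the components of `c`. -/
def IsLieBracket (v w c : VectorField) : Prop :=
  ∀ (x y : ℝ) (u : ℕ →₀ ℝ),
    Tendsto (fun L => cutAction L v w.xi x y u - cutAction L w v.xi x y u) atTop
      (𝓝 (c.xi x y u)) ∧
    Tendsto (fun L => cutAction L v w.eta x y u - cutAction L w v.eta x y u) atTop
      (𝓝 (c.eta x y u)) ∧
    ∀ n, Tendsto (fun L => cutAction L v (w.phi n) x y u - cutAction L w (v.phi n) x y u) atTop
      (𝓝 (c.phi n x y u))

end Toda

end

/-! The jet variables `ux`, `uy`, `uxx`, `uyy` are free on the equation manifold, so their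
coefficients in the symmetry condition vanish separately. This forces ξ = ξ(x), η = η(y) and φ_n =
α_n(x,y) + ∑ A_{nk} u_k with A constant (`xi_eq_of_isSymmetry`, `eta_eq_of_isSymmetry`,
`phi_affine_of_isSymmetry`).

What is left is a series in the exponentials exp((Hu)_m), with finitely many coefficients linear in
u. Since the rows of H are distinct and nonzero and its columns are finite, such a series determines
its coefficients (`coeff_eq_zero_of_tendsto`). Comparing them gives α_{xy} = 0, HA = 0 and (AK)_{nm}
= K_{nm} (ξ' + η' + (Hα)_m). Multiplying the last identity by H on the left kills AK, and because HK
has no zero column the bracket vanishes. Hence Hα = -(ξ' + η')(1,1,…) and AK = 0 (`isSymmetry_iff`).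

The rest is linear algebra. The last entry of every band row is nonzero, so the rows below the
corner form a recursion. Therefore HB = c is solvable exactly when its corner system is, and the
kernel has dimension n₀ (`finrank_kernel`); the left kernel of K is the same problem for the
transpose. Solutions α are a particular solution -(ξ' + η')b plus r(x) + s(y) times kernel vectors,
and the matrices A are combinations of products χ^j φ^l. If Hb = (1,1,…) is unsolvable, then ξ' + η'
= 0, which leaves translations and the boost. -/

noncomputable section

namespace Toda

/-! ### Semi-infinite band systems: solvability and dimension of the kernel -/

section Band

variable {M N : ℕ} {p₁ p₂ : ℤ} {H : ℕ → ℕ → ℝ}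

lemma finsum_mul_eq_sum_range {a : ℕ → ℝ} {R : ℕ} (ha : ∀ j, R ≤ j → a j = 0) (b : ℕ → ℝ) :
    ∑ᶠ j, a j * b j = ∑ j ∈ Finset.range R, a j * b j := by
  apply finsum_eq_sum_of_support_subset
  intro j hj
  by_contra h
  exact hj (by simp [ha j (by simpa using h)])

lemma IsSemiBandRows.exists_rowBound (hH : IsSemiBandRows M N p₁ p₂ H) :
    ∃ R : ℕ → ℕ, ∀ i j, R i ≤ j → H i j = 0 := by
  refine ⟨fun i => N + i + p₂.toNat + 1, fun i j hij => ?_⟩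
  beta_reduce at hij
  rcases lt_or_ge i M with hi | hi
  · exact hH.corner_zero i j hi (by omega)
  · exact hH.band_zero i j hi (Or.inr (by omega))

/-- Finiteness of rows and columns is all that the determining equations need from the band shape:
it makes every interchange of sums finite. -/
lemma IsSemiBandRows.exists_columnBound (hH : IsSemiBandRows M N p₁ p₂ H) :
    ∃ C : ℕ → ℕ, ∀ i j, C j ≤ i → H i j = 0 := by
  refine ⟨fun j => M + ((j : ℤ) - p₁).toNat + 1, fun i j hij => ?_⟩
  beta_reduce at hij
  exact hH.band_zero i j (by omega) (Or.inl (by omega))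

lemma IsSemiBandRows.corner_row (hH : IsSemiBandRows M N p₁ p₂ H) (B : ℕ → ℝ) (i : Fin M) :
    (corner H M N).mulVec (fun j => B j) i = ∑ᶠ j, H i j * B j := by
  rw [finsum_mul_eq_sum_range (fun j hj => hH.corner_zero i j i.2 hj),
    Finset.sum_range fun j => H i j * B j]
  rfl

lemma IsSemiBandRows.band_row (hH : IsSemiBandRows M N p₁ p₂ H) (B : ℕ → ℝ) {i : ℕ}
    (hi : M ≤ i) :
    ∑ σ ∈ Finset.Icc p₁ p₂, H i ((i : ℤ) + σ).toNat * B ((i : ℤ) + σ).toNat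
      = ∑ᶠ j, H i j * B j := by
  -- As i ≥ M and M + p₁ ≥ 0, every i + σ is nonnegative, so `toNat` is injective on the band.
  have h0 := hH.start_nonneg
  rw [finsum_eq_sum_of_support_subset
    (s := (Finset.Icc p₁ p₂).image fun σ => ((i : ℤ) + σ).toNat), Finset.sum_image]
  · intro a ha b hb hab
    simp only [Finset.coe_Icc, Set.mem_Icc] at ha hb
    simp only at hab
    omega
  · intro j hj
    simp only [Finset.coe_image, Finset.coe_Icc, Set.mem_image, Set.mem_Icc]
    refine ⟨j - i, ?_, by omega⟩
    by_contra hc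
    exact hj (by simp only [hH.band_zero i j hi (by omega), zero_mul])

lemma IsSemiBandRows.isRightSolution_iff (hH : IsSemiBandRows M N p₁ p₂ H) {c : ℝ}
    {B : ℕ → ℝ} :
    IsRightSolution M N p₁ p₂ H c B ↔ ∀ i, ∑ᶠ j, H i j * B j = c := by
  constructor
  · rintro ⟨h1, h2⟩ i
    rcases lt_or_ge i M with hi | hi
    · rw [← hH.corner_row B ⟨i, hi⟩, h1]
    · rw [← hH.band_row B hi, h2 i hi]
  · intro h
    refine ⟨funext fun i => ?_, fun i hi => ?_⟩
    · rw [hH.corner_row, h]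
    · rw [hH.band_row B hi, h]

lemma exists_recursive_sequence (J : ℕ) (v : ℕ → ℝ) (f : ℕ → (ℕ → ℝ) → ℝ)
    (hf : ∀ n B B', (∀ k < n, B k = B' k) → f n B = f n B') :
    ∃ B : ℕ → ℝ, (∀ j < J, B j = v j) ∧ ∀ j, J ≤ j → B j = f j B := by
  -- The recursion supplies only values below n; the others are set to 0, which is harmless because
  -- `f n` ignores them by `hf`.
  let B : ℕ → ℝ := fun n => Nat.strongRec
    (fun n ih => if n < J then v n else f n fun k => if h : k < n then ih k h else 0) n
  have hB : ∀ n, B n = if n < J then v n else f n fun k => if k < n then B k else 0 := by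
    intro n
    simp only [B]
    rw [Nat.strongRec_eq]
    simp
  refine ⟨B, fun j hj => by rw [hB, if_pos hj], fun j hj => ?_⟩
  rw [hB, if_neg (by omega)]
  exact hf _ _ _ fun k hk => by simp [hk]

/-- Row `i ≥ M` of `H B = c`, solved for the last component that it contains. -/
lemma IsSemiBandRows.row_eq_iff (hH : IsSemiBandRows M N p₁ p₂ H) {i j : ℕ} (hi : M ≤ i)
    (hij : (j : ℤ) = i + p₂) (B : ℕ → ℝ) (c : ℝ) :
    ∑ᶠ k, H i k * B k = c ↔ B j = (c - ∑ k ∈ Finset.range j, H i k * B k) / H i j := by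
  rw [finsum_mul_eq_sum_range (R := j + 1)
    (fun k hk => hH.band_zero i k hi (Or.inr (by omega))), Finset.sum_range_succ,
    eq_div_iff (hH.right_ne_zero i j hi hij)]
  constructor <;> intro h <;> linarith

/-- A solution of the finite system extends to a solution of the whole system, with arbitrary
values of the components that are not fixed by the recursion. -/
lemma IsSemiBandRows.exists_extension (hH : IsSemiBandRows M N p₁ p₂ H) (c : ℝ) (v : ℕ → ℝ)
    (hv : (corner H M N).mulVec (fun j => v j) = fun _ => c) :
    ∃ B : ℕ → ℝ, (∀ j < ((M : ℤ) + p₂).toNat, B j = v j) ∧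
      ∀ i, ∑ᶠ j, H i j * B j = c := by
  have h0 := hH.corner_le
  -- Row i ≥ M ends at column i + p₂, so component j ≥ M + p₂ is solved from row j - p₂. Since N ≤ M
  -- + p₂, the corner rows involve only prescribed components.
  obtain ⟨B, hB1, hB2⟩ := exists_recursive_sequence ((M : ℤ) + p₂).toNat v
    (fun j B => (c - ∑ k ∈ Finset.range j, H ((j : ℤ) - p₂).toNat k * B k)
      / H ((j : ℤ) - p₂).toNat j)
    (fun n B B' h => by
      rw [Finset.sum_congr rfl fun k hk => by rw [h k (Finset.mem_range.1 hk)]])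
  refine ⟨B, hB1, fun i => ?_⟩
  rcases lt_or_ge i M with hi | hi
  · rw [← hH.corner_row B ⟨i, hi⟩]
    have : (fun j : Fin N => B j) = fun j : Fin N => v j :=
      funext fun j => hB1 j (by have := j.2; omega)
    rw [this, hv]
  · rw [hH.row_eq_iff (j := ((i : ℤ) + p₂).toNat) hi (by omega), hB2 _ (by omega)]
    have : (((((i : ℤ) + p₂).toNat : ℕ) : ℤ) - p₂).toNat = i := by omega
    rw [this]

lemma IsSemiBandRows.eq_zero_of_start (hH : IsSemiBandRows M N p₁ p₂ H) {B : ℕ → ℝ}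
    (hB : ∀ i, ∑ᶠ j, H i j * B j = 0) (hB0 : ∀ j < ((M : ℤ) + p₂).toNat, B j = 0) : B = 0 := by
  have h0 := hH.corner_le
  funext j
  induction j using Nat.strong_induction_on with
  | _ j ih =>
    rcases lt_or_ge j ((M : ℤ) + p₂).toNat with hj | hj
    · exact hB0 j hj
    · have := (hH.row_eq_iff (i := ((j : ℤ) - p₂).toNat) (j := j) (by omega) (by omega) B 0).1
        (hB _)
      rw [this, Finset.sum_eq_zero fun k hk => by
        rw [ih k (Finset.mem_range.1 hk), Pi.zero_apply, mul_zero]]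
      simp

lemma IsSemiBandRows.one_mem_range_iff (hH : IsSemiBandRows M N p₁ p₂ H) :
    (fun _ => (1 : ℝ)) ∈ LinearMap.range (corner H M N).mulVecLin ↔
      ∃ b : ℕ → ℝ, ∀ i, ∑ᶠ j, H i j * b j = 1 := by
  constructor
  · rintro ⟨w, hw⟩
    obtain ⟨b, -, hb⟩ := hH.exists_extension 1 (fun j => if h : j < N then w ⟨j, h⟩ else 0)
      (by simpa using hw)
    exact ⟨b, hb⟩
  · rintro ⟨b, hb⟩
    exact ⟨fun j => b j, (hH.isRightSolution_iff.2 hb).1⟩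

/-- The solutions of `H B = 0`. -/
def kernel (hH : IsSemiBandRows M N p₁ p₂ H) : Submodule ℝ (ℕ → ℝ) where
  carrier := {B | ∀ i, ∑ᶠ j, H i j * B j = 0}
  zero_mem' := fun i => by simp
  add_mem' := by
    intro a b ha hb i
    obtain ⟨R, hR⟩ := hH.exists_rowBound
    have h1 := ha i
    have h2 := hb i
    rw [finsum_mul_eq_sum_range (hR i)] at h1 h2 ⊢
    simp only [Pi.add_apply, mul_add, Finset.sum_add_distrib, h1, h2, add_zero]
  smul_mem' := by
    intro c a ha i
    obtain ⟨R, hR⟩ := hH.exists_rowBound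
    have h1 := ha i
    rw [finsum_mul_eq_sum_range (hR i)] at h1 ⊢
    simp only [Pi.smul_apply, smul_eq_mul, mul_left_comm _ c, ← Finset.mul_sum, h1, mul_zero]

/-- The first `J` components of a sequence. -/
def firstTerms (J : ℕ) : (ℕ → ℝ) →ₗ[ℝ] (Fin J → ℝ) :=
  LinearMap.funLeft ℝ ℝ fun i : Fin J => (i : ℕ)

lemma IsSemiBandRows.firstTerms_injective (hH : IsSemiBandRows M N p₁ p₂ H) :
    Function.Injective ((firstTerms ((M : ℤ) + p₂).toNat).domRestrict (kernel hH)) := by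
  rw [← LinearMap.ker_eq_bot, LinearMap.ker_eq_bot']
  rintro ⟨B, hB⟩ h
  apply Subtype.ext
  exact hH.eq_zero_of_start hB fun j hj => congrFun h ⟨j, hj⟩

lemma IsSemiBandRows.finiteDimensional_kernel (hH : IsSemiBandRows M N p₁ p₂ H) :
    FiniteDimensional ℝ (kernel hH) :=
  Module.Finite.of_injective _ hH.firstTerms_injective

/-- Truncation to the first J = M + p₂ components is injective on the kernel, and its image consists
of the vectors whose first N components lie in the kernel of the corner block. The other J - N
components are free. Rank-nullity for `T` and for the corner block, which have the same range, turns
this into the count. -/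
lemma IsSemiBandRows.finrank_kernel (hH : IsSemiBandRows M N p₁ p₂ H) :
    Module.finrank ℝ (kernel hH) = (gaugeNumber M N p₂ H).toNat := by
  have h0 := hH.corner_le
  set J := ((M : ℤ) + p₂).toNat with hJ
  have hNJ : N ≤ J := by omega
  let π : (Fin J → ℝ) →ₗ[ℝ] (Fin N → ℝ) := LinearMap.funLeft ℝ ℝ (Fin.castLE hNJ)
  have hπ : LinearMap.range π = ⊤ := LinearMap.range_eq_top.2
    (LinearMap.funLeft_surjective_of_injective ℝ ℝ _ (Fin.castLE_injective hNJ))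
  let T := (corner H M N).mulVecLin ∘ₗ π
  have hrange : LinearMap.range ((firstTerms J).domRestrict (kernel hH)) = LinearMap.ker T := by
    ext v
    constructor
    · rintro ⟨⟨B, hB⟩, rfl⟩
      exact ((hH.isRightSolution_iff (c := 0)).2 hB).1
    · intro hv
      obtain ⟨B, hB1, hB2⟩ := hH.exists_extension 0
        (fun j => if h : j < J then v ⟨j, h⟩ else 0) (by
          have hv' : (corner H M N).mulVec (π v) = 0 := hv
          refine Eq.trans (congrArg _ (funext fun j => ?_)) hv'
          rw [dif_pos (lt_of_lt_of_le j.2 hNJ)]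
          rfl)
      refine ⟨⟨B, hB2⟩, funext fun j => ?_⟩
      have := hB1 j j.2
      rw [dif_pos j.2] at this
      exact this
  have h1 := LinearMap.finrank_range_of_inj hH.firstTerms_injective
  have h2 := LinearMap.finrank_range_add_finrank_ker T
  have h3 := LinearMap.finrank_range_add_finrank_ker (corner H M N).mulVecLin
  have h4 : LinearMap.range T = LinearMap.range (corner H M N).mulVecLin :=
    LinearMap.range_comp_of_range_eq_top _ hπ
  rw [h4] at h2
  simp only [Module.finrank_fin_fun] at h2 h3
  rw [← h1, hrange, gaugeNumber]
  have h5 : (J : ℤ) = M + p₂ := by omega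
  have h6 : (Module.finrank ℝ (LinearMap.ker T) : ℤ)
      = (M : ℤ) - N + p₂ + Module.finrank ℝ (LinearMap.ker (corner H M N).mulVecLin) := by
    linarith [congrArg (Nat.cast : ℕ → ℤ) h2, congrArg (Nat.cast : ℕ → ℤ) h3,
      Nat.cast_add (R := ℤ) (Module.finrank ℝ (LinearMap.range (corner H M N).mulVecLin))
        (Module.finrank ℝ (LinearMap.ker T)),
      Nat.cast_add (R := ℤ) (Module.finrank ℝ (LinearMap.range (corner H M N).mulVecLin))
        (Module.finrank ℝ (LinearMap.ker (corner H M N).mulVecLin))]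
  rw [← h6, Int.toNat_natCast]

lemma IsSemiBandRows.exists_basis (hH : IsSemiBandRows M N p₁ p₂ H) :
    ∃ χ : Fin (gaugeNumber M N p₂ H).toNat → ℕ → ℝ, LinearIndependent ℝ χ ∧
      Submodule.span ℝ (Set.range χ) = kernel hH := by
  have := hH.finiteDimensional_kernel
  let b := Module.finBasisOfFinrankEq ℝ (kernel hH) hH.finrank_kernel
  refine ⟨fun j => b j, b.linearIndependent.map' (kernel hH).subtype (Submodule.ker_subtype _), ?_⟩
  have := congrArg (Submodule.map (kernel hH).subtype) b.span_eq
  rw [Submodule.map_span, Submodule.map_top, Submodule.range_subtype, ← Set.range_comp] at this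
  exact this

/-- Coordinates with respect to a basis of the solutions of `H B = 0` are linear functions of
finitely many components. -/
lemma IsSemiBandRows.exists_coordinates (hH : IsSemiBandRows M N p₁ p₂ H) {n : ℕ}
    {χ : Fin n → ℕ → ℝ} (hχ : LinearIndependent ℝ χ)
    (hspan : Submodule.span ℝ (Set.range χ) = kernel hH) :
    ∃ (J : ℕ) (g : (Fin J → ℝ) →ₗ[ℝ] (Fin n → ℝ)), ∀ B, (∀ i, ∑ᶠ j, H i j * B j = 0) →
      B = ∑ j, g (firstTerms J B) j • χ j := by
  refine ⟨((M : ℤ) + p₂).toNat, ?_⟩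
  set J := ((M : ℤ) + p₂).toNat with hJ
  have hmem : ∀ c : Fin n → ℝ, ∑ j, c j • χ j ∈ kernel hH := fun c => by
    rw [← hspan]
    exact Submodule.sum_mem _ fun j _ => Submodule.smul_mem _ _ (Submodule.subset_span ⟨j, rfl⟩)
  -- A linear left inverse of c ↦ first J components of ∑ c_j χ^j. Its linearity on a
  -- finite-dimensional space later makes the coordinates of a smooth family of solutions smooth.
  obtain ⟨g, hg⟩ := LinearMap.exists_leftInverse_of_injective
    ((firstTerms J) ∘ₗ Fintype.linearCombination ℝ χ) (by
      rw [LinearMap.ker_eq_bot']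
      intro c hc
      have h1 : ∑ j, c j • χ j = 0 := by
        apply hH.eq_zero_of_start (hmem c)
        intro j hj
        exact congrFun hc ⟨j, hj⟩
      funext j
      exact Fintype.linearIndependent_iff.1 hχ c h1 j)
  refine ⟨g, fun B hB => ?_⟩
  have hB' : B ∈ Submodule.span ℝ (Set.range χ) := by rw [hspan]; exact hB
  obtain ⟨c, rfl⟩ := (Submodule.mem_span_range_iff_exists_fun ℝ).1 hB'
  have : g (firstTerms J (∑ j, c j • χ j)) = c := LinearMap.congr_fun hg c
  rw [this]

end Band

/-! ### Uniqueness of coefficients of exponential series -/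

section Exponentials

/-- Translation of the argument by `1`. -/
def shift : Module.End ℝ (ℝ → ℝ) := LinearMap.funLeft ℝ ℝ fun s => s + 1

lemma shift_apply (f : ℝ → ℝ) (s : ℝ) : shift f s = f (s + 1) := rfl

/-- Subtracting exp μ from `shift` lowers the degree of the polynomial factor, so the second power
annihilates the function. -/
lemma exp_mem_maxGenEigenspace_shift (A B μ : ℝ) :
    (fun s => (A + B * s) * Real.exp (μ * s)) ∈ shift.maxGenEigenspace (Real.exp μ) := by
  rw [Module.End.mem_maxGenEigenspace]
  have key : ∀ A B : ℝ, (shift - Real.exp μ • (1 : Module.End ℝ (ℝ → ℝ)))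
      (fun s => (A + B * s) * Real.exp (μ * s))
      = fun s => (B * Real.exp μ + 0 * s) * Real.exp (μ * s) := by
    intro A B
    funext s
    simp only [LinearMap.sub_apply, LinearMap.smul_apply, Module.End.one_apply, Pi.sub_apply,
      Pi.smul_apply, shift_apply, smul_eq_mul, mul_add, mul_one, Real.exp_add]
    ring
  refine ⟨2, ?_⟩
  rw [pow_two, Module.End.mul_apply, key, key]
  funext s
  simp

/-- In a vanishing sum of terms `(A + B s) exp (μ s)`, a term with a frequency different from all
others vanishes. -/
lemma coeff_eq_zero_of_sum_exp_eq_zero {ι : Type*} (I : Finset ι) (A B μ : ι → ℝ) (T : ℝ)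
    {i₀ : ι} (hi₀ : i₀ ∈ I) (hμ : ∀ i ∈ I, i ≠ i₀ → μ i ≠ μ i₀) (hμ₀ : μ i₀ ≠ 0)
    (h : ∀ s, ∑ i ∈ I, (A i + B i * s) * Real.exp (μ i * s) + T = 0) : A i₀ = 0 := by
  classical
  let f : ι → ℝ → ℝ := fun i s => (A i + B i * s) * Real.exp (μ i * s)
  have hf : ∀ i, f i ∈ shift.maxGenEigenspace (Real.exp (μ i)) := fun i =>
    exp_mem_maxGenEigenspace_shift _ _ _
  have hT : (fun _ : ℝ => T) ∈ shift.maxGenEigenspace (Real.exp 0) := by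
    simpa using exp_mem_maxGenEigenspace_shift T 0 0
  have hsum : f i₀ = -(∑ i ∈ I.erase i₀, f i + fun _ => T) := by
    funext s
    have := h s
    rw [← Finset.add_sum_erase _ _ hi₀] at this
    simp only [Pi.neg_apply, Pi.add_apply, Finset.sum_apply, f]
    linarith
  -- Generalized eigenspaces of `shift` are independent, and the term lies in its own one as well as
  -- in the sum of the others. The constant T has eigenvalue exp 0, hence the assumption μ i₀ ≠ 0.
  have hmem : f i₀ ∈ ⨆ j, ⨆ (_ : j ≠ Real.exp (μ i₀)), shift.maxGenEigenspace j := by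
    rw [hsum]
    refine Submodule.neg_mem _ (Submodule.add_mem _ (Submodule.sum_mem _ fun i hi => ?_) ?_)
    · refine Submodule.mem_iSup_of_mem (Real.exp (μ i)) (Submodule.mem_iSup_of_mem ?_ (hf i))
      exact fun e => hμ i (Finset.mem_of_mem_erase hi) (Finset.ne_of_mem_erase hi)
        (Real.exp_injective e)
    · refine Submodule.mem_iSup_of_mem (Real.exp 0) (Submodule.mem_iSup_of_mem ?_ hT)
      exact fun e => hμ₀ (Real.exp_injective e).symm
  have hzero : f i₀ = 0 := by
    have := (iSupIndep_def.1 (Module.End.independent_maxGenEigenspace shift))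
      (Real.exp (μ i₀))
    exact Submodule.disjoint_def.1 this _ (hf i₀) hmem
  simpa [f] using congrFun hzero 0

/-- The linear function `∑ l, H m l * u l`. -/
def exponent (H : ℕ → ℕ → ℝ) (m : ℕ) : (ℕ →₀ ℝ) →ₗ[ℝ] ℝ := Finsupp.linearCombination ℝ (H m)

lemma expTerm_eq (H : ℕ → ℕ → ℝ) (m : ℕ) (u : ℕ →₀ ℝ) :
    expTerm H m u = Real.exp (exponent H m u) := by
  simp [expTerm, exponent, Finsupp.linearCombination_apply, mul_comm]

lemma exponent_eq_zero {H : ℕ → ℕ → ℝ} {m : ℕ} {J : Set ℕ} (hm : ∀ j ∈ J, H m j = 0)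
    {u : ℕ →₀ ℝ} (hu : u ∈ Finsupp.supported ℝ ℝ J) : exponent H m u = 0 := by
  rw [exponent, Finsupp.linearCombination_apply]
  exact Finset.sum_eq_zero fun j hj => by
    simp [hm j ((Finsupp.mem_supported ℝ u).1 hu hj)]

variable {H : ℕ → ℕ → ℝ} {C : ℕ → ℕ}

/-- Restricted to sufficiently many columns, a given row is nonzero and differs from all
others. -/
lemma exists_separating_columns (hC : ∀ i j, C j ≤ i → H i j = 0)
    (hrows : Function.Injective H) (hrow_ne : ∀ i, H i ≠ 0) (m₀ : ℕ) :
    ∃ J₀ : ℕ, (∃ j < J₀, H m₀ j ≠ 0) ∧ ∀ m ≠ m₀, ∃ j < J₀, H m j ≠ H m₀ j := by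
  obtain ⟨l, hl⟩ := Function.ne_iff.1 (hrow_ne m₀)
  have hsep : ∀ m, ∃ j, m ≠ m₀ → H m j ≠ H m₀ j := by
    intro m
    by_cases h : m = m₀
    · exact ⟨0, fun h' => absurd h h'⟩
    · obtain ⟨j, hj⟩ := Function.ne_iff.1 (fun e => h (hrows e))
      exact ⟨j, fun _ => hj⟩
  choose sep hsep using hsep
  -- Rows from `C l` on vanish in column l and so differ from row m₀ there; only finitely many rows
  -- need a separating column of their own.
  refine ⟨l + 1 + (Finset.range (C l)).sup (fun m => sep m + 1), ⟨l, by omega, hl⟩,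
    fun m hm => ?_⟩
  rcases lt_or_ge m (C l) with h | h
  · have := Finset.le_sup (f := fun m => sep m + 1) (Finset.mem_range.2 h)
    exact ⟨sep m, by omega, hsep m hm⟩
  · exact ⟨l, by omega, fun e => hl (by rw [← e, hC m l h]; rfl)⟩

/-- Convergent series in the exponentials `exp (∑ l, H m l * u l)` have unique coefficients, also
if finitely many terms with coefficients that are linear in `u` occur. -/
theorem coeff_eq_zero_of_tendsto (hC : ∀ i j, C j ≤ i → H i j = 0)
    (hrows : Function.Injective H) (hrow_ne : ∀ i, H i ≠ 0)
    (c : ℕ → ℝ) (d : ℕ → (ℕ →₀ ℝ) →ₗ[ℝ] ℝ) (S : ℕ) (hd : ∀ m, S ≤ m → d m = 0) (a : ℝ)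
    (h : ∀ u, Tendsto (fun L => ∑ m ∈ Finset.range L, c m * expTerm H m u) atTop
      (𝓝 (a + ∑ m ∈ Finset.range S, d m u * expTerm H m u))) :
    (∀ m, c m = 0) ∧ (∀ m, d m = 0) ∧ a = 0 := by
  have hzero : Tendsto (fun L => ∑ m ∈ Finset.range L, c m) atTop (𝓝 a) := by
    simpa [expTerm_eq] using h 0
  have key : ∀ m₀ u₀, c m₀ = d m₀ u₀ := by
    intro m₀ u₀
    obtain ⟨J₀, hJ₁, hJ₂⟩ := exists_separating_columns hC hrows hrow_ne m₀
    -- V consists of the u supported in the first J columns and contains u₀. On V all exponentials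
    -- from index P on equal 1, because columns are finite, so the series collapses to a finite sum
    -- plus a constant.
    set J : ℕ := J₀ + u₀.support.sup (fun j => j + 1) with hJ
    set P : ℕ := S + (m₀ + 1) + (Finset.range J).sup C with hP
    set V := Finsupp.supported ℝ ℝ (Set.Iio J) with hV
    have hu₀ : u₀ ∈ V := by
      rw [hV, Finsupp.mem_supported]
      intro j hj
      have := Finset.le_sup (f := fun j => j + 1) hj
      simp only [Set.mem_Iio]
      omega
    have hlarge : ∀ m, P ≤ m → ∀ u ∈ V, expTerm H m u = 1 := by
      intro m hm u hu
      rw [expTerm_eq, exponent_eq_zero (fun j hj => ?_) hu, Real.exp_zero]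
      have := Finset.le_sup (f := C) (Finset.mem_range.2 hj)
      exact hC m j (by omega)
    have hfin : ∀ u ∈ V, ∑ m ∈ Finset.range P, (c m - d m u) * expTerm H m u
        + -∑ m ∈ Finset.range P, c m = 0 := by
      intro u hu
      have e1 : Tendsto (fun L => ∑ m ∈ Finset.range L, c m * expTerm H m u) atTop
          (𝓝 (a + (∑ m ∈ Finset.range P, c m * expTerm H m u - ∑ m ∈ Finset.range P, c m))) := by
        refine (hzero.add_const _).congr' ?_
        filter_upwards [eventually_ge_atTop P] with L hL
        rw [← Finset.sum_range_add_sum_Ico c hL,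
          ← Finset.sum_range_add_sum_Ico (fun m => c m * expTerm H m u) hL,
          Finset.sum_congr (s₁ := Finset.Ico P L) rfl fun m hm => by
            rw [← mul_one (c m), ← hlarge m (Finset.mem_Ico.1 hm).1 u hu]]
        ring
      have e2 := tendsto_nhds_unique e1 (h u)
      have e3 : ∑ m ∈ Finset.range P, d m u * expTerm H m u
          = ∑ m ∈ Finset.range S, d m u * expTerm H m u := by
        symm
        apply Finset.sum_subset
        · exact Finset.range_mono (by omega)
        · intro m _ hm
          rw [hd m (by simpa using hm)]
          simp
      rw [← e3] at e2
      simp only [sub_mul, Finset.sum_sub_distrib]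
      linarith
    -- A direction outside finitely many hyperplanes of V: along it the frequency of m₀ is nonzero
    -- and differs from all the other frequencies.
    obtain ⟨w, hwV, hw⟩ := Module.Dual.exists_forall_mem_ne_zero_of_forall_exists V
      (fun m : Fin P => if (m : ℕ) = m₀ then exponent H m₀ else exponent H m - exponent H m₀)
      (fun m => by
        by_cases hm : (m : ℕ) = m₀
        · obtain ⟨j, hj, hne⟩ := hJ₁
          refine ⟨Finsupp.single j 1, Finsupp.single_mem_supported ℝ 1 ?_, ?_⟩
          · simp only [Set.mem_Iio]; omega
          · simpa [hm, exponent] using hne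
        · obtain ⟨j, hj, hne⟩ := hJ₂ m hm
          refine ⟨Finsupp.single j 1, Finsupp.single_mem_supported ℝ 1 ?_, ?_⟩
          · simp only [Set.mem_Iio]; omega
          · simpa [hm, exponent, sub_eq_zero] using hne)
    -- On the line u₀ + s w the coefficients c m - d m are affine in s, which is the form that the
    -- one-variable lemma handles.
    have hcoeff := coeff_eq_zero_of_sum_exp_eq_zero (Finset.range P)
      (fun m => (c m - d m u₀) * expTerm H m u₀) (fun m => -(d m w) * expTerm H m u₀)
      (fun m => exponent H m w) (-∑ m ∈ Finset.range P, c m) (i₀ := m₀)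
      (Finset.mem_range.2 (by omega))
      (fun m hm hne e => by
        have := hw ⟨m, Finset.mem_range.1 hm⟩
        rw [if_neg hne] at this
        exact this (by simp [e]))
      (by simpa using hw ⟨m₀, by omega⟩)
      (fun s => by
        rw [← hfin (u₀ + s • w) (V.add_mem hu₀ (V.smul_mem s hwV))]
        congr 1
        refine Finset.sum_congr rfl fun m _ => ?_
        simp only [expTerm_eq, map_add, map_smul, smul_eq_mul, Real.exp_add, mul_comm s]
        ring)
    have hpos : expTerm H m₀ u₀ ≠ 0 := by rw [expTerm_eq]; exact (Real.exp_pos _).ne'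
    exact sub_eq_zero.1 ((mul_eq_zero.1 hcoeff).resolve_right hpos)
  -- A linear function that is constantly `c m` vanishes, as its value at 0 shows.
  have hc : ∀ m, c m = 0 := fun m => by simpa using key m 0
  refine ⟨hc, fun m => LinearMap.ext fun u => by rw [← key m u, hc m]; rfl, ?_⟩
  simp only [hc, Finset.sum_const_zero] at hzero
  exact tendsto_nhds_unique hzero tendsto_const_nhds

end Exponentials

/-! ### Calculus for functions of infinitely many fields -/

section Calculus

/-- The field values with components `v 0, …, v (n - 1), 0, 0, …`. -/
def embed (n : ℕ) (v : Fin n → ℝ) : ℕ →₀ ℝ := ∑ i : Fin n, Finsupp.single (i : ℕ) (v i)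

lemma embed_apply (n : ℕ) (v : Fin n → ℝ) (j : ℕ) :
    embed n v j = if h : j < n then v ⟨j, h⟩ else 0 := by
  rw [embed, Finsupp.finsetSum_apply]
  split_ifs with h
  · rw [Finset.sum_eq_single ⟨j, h⟩]
    · simp
    · intro b _ hb
      rw [Finsupp.single_apply, if_neg]
      exact fun e => hb (Fin.ext e)
    · simp
  · refine Finset.sum_eq_zero fun i _ => ?_
    rw [Finsupp.single_apply, if_neg]
    omega

lemma exists_eq_embed (u : ℕ →₀ ℝ) : ∃ n v, u = embed n v := by
  refine ⟨u.support.sup (fun j => j + 1), fun i => u i, Finsupp.ext fun j => ?_⟩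
  rw [embed_apply]
  split_ifs with h
  · rfl
  · by_contra hj
    have := Finset.le_sup (f := fun j => j + 1) (Finsupp.mem_support_iff.2 hj)
    omega

/-- Shift of the component `k`, inside a space with at least `k + 1` components. -/
def extend (n k : ℕ) (v : Fin n → ℝ) (t : ℝ) (j : Fin (n + k + 1)) : ℝ :=
  (if h : (j : ℕ) < n then v ⟨j, h⟩ else 0) + if (j : ℕ) = k then t else 0

/-- Moving u_k leaves the slice of the first n fields but stays in the slice of the first n + k + 1.
Smoothness on all finite slices is therefore stable under ∂/∂u_k. -/
lemma embed_add_single (n k : ℕ) (v : Fin n → ℝ) (t : ℝ) :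
    embed n v + Finsupp.single k t = embed (n + k + 1) (extend n k v t) := by
  ext j
  rw [Finsupp.add_apply, embed_apply, embed_apply, Finsupp.single_apply]
  by_cases h : j < n + k + 1
  · rw [dif_pos h]
    simp only [extend, eq_comm]
  · rw [dif_neg h, dif_neg (by omega), if_neg (by omega), add_zero]

variable {X : Type*} [NormedAddCommGroup X] [NormedSpace ℝ X]

lemma contDiff_extend (n k : ℕ) {v : X → Fin n → ℝ} {t : X → ℝ} (hv : ContDiff ℝ ∞ v)
    (ht : ContDiff ℝ ∞ t) : ContDiff ℝ ∞ fun p => extend n k (v p) (t p) := by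
  rw [contDiff_pi]
  intro j
  refine ContDiff.add ?_ ?_
  · split_ifs with h
    · exact contDiff_pi.1 hv ⟨j, h⟩
    · exact contDiff_const
  · split_ifs
    · exact ht
    · exact contDiff_const

variable {f g : Coef}

lemma SmoothCoef.comp (hf : SmoothCoef f) {n : ℕ} {a b : X → ℝ} {w : X → Fin n → ℝ}
    (ha : ContDiff ℝ ∞ a) (hb : ContDiff ℝ ∞ b) (hw : ContDiff ℝ ∞ w) :
    ContDiff ℝ ∞ fun p => f (a p) (b p) (embed n (w p)) :=
  (hf n).comp (ha.prodMk (hb.prodMk hw))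

lemma SmoothCoef.comp_const (hf : SmoothCoef f) {a b : X → ℝ}
    (ha : ContDiff ℝ ∞ a) (hb : ContDiff ℝ ∞ b) (u : ℕ →₀ ℝ) :
    ContDiff ℝ ∞ fun p => f (a p) (b p) u := by
  obtain ⟨n, v, rfl⟩ := exists_eq_embed u
  exact hf.comp ha hb contDiff_const

lemma SmoothCoef.contDiff_single (hf : SmoothCoef f) (x y : ℝ) (u : ℕ →₀ ℝ) (k : ℕ) :
    ContDiff ℝ ∞ fun t => f x y (u + Finsupp.single k t) := by
  obtain ⟨n, v, rfl⟩ := exists_eq_embed u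
  simp only [embed_add_single]
  exact hf.comp contDiff_const contDiff_const (contDiff_extend n k contDiff_const contDiff_id)

lemma contDiff_deriv_param {F : X → ℝ → ℝ} {t : X → ℝ}
    (hF : ContDiff ℝ ∞ (Function.uncurry F)) (ht : ContDiff ℝ ∞ t) :
    ContDiff ℝ ∞ fun p => deriv (F p) (t p) := by
  have h := ContDiff.fderiv (n := ∞) hF ht (by simp)
  exact h.clm_apply contDiff_const

lemma SmoothCoef.du (hf : SmoothCoef f) (k : ℕ) : SmoothCoef (du k f) := by
  intro n
  have : ContDiff ℝ ∞ (Function.uncurry fun (p : ℝ × ℝ × (Fin n → ℝ)) (t : ℝ) =>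
      f p.1 p.2.1 (embed n p.2.2 + Finsupp.single k t)) := by
    simp only [embed_add_single]
    exact hf.comp (by fun_prop) (by fun_prop) (contDiff_extend n k (by fun_prop) (by fun_prop))
  exact contDiff_deriv_param this contDiff_const

lemma SmoothCoef.dy (hf : SmoothCoef f) : SmoothCoef (dy f) := by
  intro n
  have : ContDiff ℝ ∞ (Function.uncurry fun (p : ℝ × ℝ × (Fin n → ℝ)) (t : ℝ) =>
      f p.1 t (embed n p.2.2)) :=
    hf.comp (by fun_prop) (by fun_prop) (by fun_prop)
  exact contDiff_deriv_param this (by fun_prop)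

lemma SmoothCoef.differentiable_x (hf : SmoothCoef f) (y : ℝ) (u : ℕ →₀ ℝ) :
    Differentiable ℝ fun t => f t y u :=
  (hf.comp_const contDiff_id contDiff_const u).differentiable (by simp)

lemma SmoothCoef.differentiable_y (hf : SmoothCoef f) (x : ℝ) (u : ℕ →₀ ℝ) :
    Differentiable ℝ fun t => f x t u :=
  (hf.comp_const contDiff_const contDiff_id u).differentiable (by simp)

lemma SmoothCoef.differentiable_single (hf : SmoothCoef f) (x y : ℝ) (u : ℕ →₀ ℝ) (k : ℕ) :
    Differentiable ℝ fun t => f x y (u + Finsupp.single k t) :=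
  (hf.contDiff_single x y u k).differentiable (by simp)

lemma eq_of_dx_eq_zero (hf : SmoothCoef f) {y : ℝ} {u : ℕ →₀ ℝ} (h : ∀ x, dx f x y u = 0)
    (x x' : ℝ) : f x y u = f x' y u :=
  is_const_of_deriv_eq_zero (hf.differentiable_x y u) h x x'

lemma eq_of_dy_eq_zero (hf : SmoothCoef f) {x : ℝ} {u : ℕ →₀ ℝ} (h : ∀ y, dy f x y u = 0)
    (y y' : ℝ) : f x y u = f x y' u :=
  is_const_of_deriv_eq_zero (hf.differentiable_y x u) h y y'

lemma deriv_single (f : Coef) (x y : ℝ) (u : ℕ →₀ ℝ) (k : ℕ) (t : ℝ) :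
    deriv (fun t => f x y (u + Finsupp.single k t)) t
      = du k f x y (u + Finsupp.single k t) := by
  have h := deriv_comp_const_add (fun s => f x y (u + Finsupp.single k s)) t 0
  rw [add_zero] at h
  rw [← h, Toda.du]
  simp only [Finsupp.single_add, add_assoc]

/-- Field values have finite support, so 0 is reached by finitely many moves along coordinate axes.
-/
lemma eq_of_du_eq_zero (hf : SmoothCoef f) {x y : ℝ} (h : ∀ k u, du k f x y u = 0)
    (u : ℕ →₀ ℝ) : f x y u = f x y 0 := by
  induction u using Finsupp.induction with
  | zero => rfl
  | single_add k a u _ _ ih =>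
    rw [← ih, add_comm]
    have := is_const_of_deriv_eq_zero (hf.differentiable_single x y u k)
      (fun t => by rw [deriv_single, h]) a 0
    simpa using this

lemma eq_const_of_derivs_eq_zero (hf : SmoothCoef f) (hx : dx f = 0) (hy : dy f = 0)
    (hu : ∀ k, du k f = 0) (x y : ℝ) (u : ℕ →₀ ℝ) : f x y u = f 0 0 0 := by
  rw [eq_of_du_eq_zero hf (fun k u => by rw [hu]; rfl) u,
    eq_of_dx_eq_zero hf (fun x => by rw [hx]; rfl) x 0,
    eq_of_dy_eq_zero hf (fun x => by rw [hy]; rfl) y 0]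

/-- The linear function `∑ k, a k * u k`. -/
abbrev lin (a : ℕ → ℝ) : (ℕ →₀ ℝ) →ₗ[ℝ] ℝ := Finsupp.linearCombination ℝ a

lemma sum_eq_lin (a : ℕ → ℝ) (u : ℕ →₀ ℝ) : (u.sum fun m t => a m * t) = lin a u := by
  simp [lin, Finsupp.linearCombination_apply, mul_comm]

lemma lin_single (a : ℕ → ℝ) (k : ℕ) (t : ℝ) : lin a (Finsupp.single k t) = t * a k := by
  simp [lin]

lemma lin_embed (a : ℕ → ℝ) (n : ℕ) (v : Fin n → ℝ) : lin a (embed n v) = ∑ i, v i * a i := by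
  simp [embed, lin]

lemma smoothCoef_affine {α : ℝ → ℝ → ℝ} (hα : ContDiff ℝ ∞ (Function.uncurry α)) (a : ℕ → ℝ) :
    SmoothCoef fun x y u => α x y + lin a u := by
  intro n
  change ContDiff ℝ ∞ fun p : ℝ × ℝ × (Fin n → ℝ) => α p.1 p.2.1 + lin a (embed n p.2.2)
  simp only [lin_embed]
  refine ContDiff.add ?_ (by fun_prop)
  exact hα.comp (contDiff_fst.prodMk (contDiff_fst.comp contDiff_snd))

lemma du_affine (α : ℝ → ℝ → ℝ) (a : ℕ → ℝ) (k : ℕ) :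
    du k (fun x y u => α x y + lin a u) = fun _ _ _ => a k := by
  funext x y u
  simp only [du, map_add, lin_single]
  simp

/-- A function whose second derivatives that involve some `u_k` vanish is affine in `u`, with
constant linear part. -/
lemma exists_affine (hf : SmoothCoef f) (hx : ∀ k, dx (du k f) = 0) (hy : ∀ k, dy (du k f) = 0)
    (hu : ∀ k l, du k (du l f) = 0) :
    ∃ a : ℕ → ℝ, f = fun x y u => f x y 0 + lin a u := by
  have h1 : ∀ k x y u, du k f x y u = du k f 0 0 0 := fun k =>
    eq_const_of_derivs_eq_zero (hf.du k) (hx k) (hy k) (fun l => hu l k)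
  refine ⟨fun k => du k f 0 0 0, ?_⟩
  funext x y u
  induction u using Finsupp.induction with
  | zero => simp
  | single_add k a u _ _ ih =>
    have h2 : Differentiable ℝ fun t => f x y (u + Finsupp.single k t) - t * du k f 0 0 0 :=
      (hf.differentiable_single x y u k).sub (by fun_prop)
    have := is_const_of_deriv_eq_zero h2 (fun t => by
      rw [deriv_fun_sub (hf.differentiable_single x y u k t) (by fun_prop), deriv_single, h1]
      simp) a 0
    simp only [Finsupp.single_zero, add_zero, zero_mul, sub_zero] at this
    rw [add_comm, map_add, lin_single]
    linarith

lemma contDiff_zero_fields (hf : SmoothCoef f) :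
    ContDiff ℝ ∞ (Function.uncurry fun x y => f x y 0) :=
  hf.comp_const contDiff_fst contDiff_snd 0

/-- Solutions of the wave equation in light cone coordinates. -/
lemma eq_add_of_dx_dy_eq_zero (hf : SmoothCoef f) (u : ℕ →₀ ℝ)
    (h : ∀ x y, dx (dy f) x y u = 0) (x y : ℝ) :
    f x y u = f x 0 u + f 0 y u - f 0 0 u := by
  have h1 : ∀ y, dy f x y u = dy f 0 y u := fun y =>
    eq_of_dx_eq_zero hf.dy (fun x => h x y) x 0
  have h2 := is_const_of_deriv_eq_zero
    ((hf.differentiable_y x u).sub (hf.differentiable_y 0 u)) (fun t => by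
      rw [deriv_sub (hf.differentiable_y x u t) (hf.differentiable_y 0 u t)]
      exact sub_eq_zero.2 (h1 t)) y 0
  simp only [Pi.sub_apply] at h2
  linarith

end Calculus

/-! ### The determining equations -/

section Determining

variable {H K : ℕ → ℕ → ℝ} {R S T : ℕ → ℕ}

lemma finsum_sum_mul_eq {P : ℕ} {b : ℕ → ℕ → ℝ} {Q : ℕ → ℕ} (hb : ∀ m k, Q m ≤ k → b m k = 0)
    (φ : ℕ → ℝ) :
    ∑ᶠ k, (∑ m ∈ Finset.range P, b m k) * φ k
      = ∑ m ∈ Finset.range P, ∑ᶠ k, b m k * φ k := by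
  rw [finsum_mul_eq_sum_range (R := (Finset.range P).sup Q), Finset.sum_congr rfl fun m hm =>
    finsum_mul_eq_sum_range (R := (Finset.range P).sup Q)
      (fun k hk => hb m k ((Finset.le_sup hm).trans hk)) φ]
  · simp only [Finset.sum_mul]
    exact Finset.sum_comm
  · exact fun k hk => Finset.sum_eq_zero fun m hm => hb m k ((Finset.le_sup hm).trans hk)

lemma finsum_mul_finsum_comm {a : ℕ → ℝ} {b : ℕ → ℝ} {P Q : ℕ} (ha : ∀ k, P ≤ k → a k = 0)
    (hb : ∀ k, Q ≤ k → b k = 0) (B : ℕ → ℕ → ℝ) :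
    ∑ᶠ k, a k * ∑ᶠ l, b l * B k l = ∑ᶠ l, b l * ∑ᶠ k, a k * B k l := by
  simp only [finsum_mul_eq_sum_range ha, finsum_mul_eq_sum_range hb]
  simp only [Finset.mul_sum]
  rw [Finset.sum_comm]
  exact Finset.sum_congr rfl fun l _ => Finset.sum_congr rfl fun k _ => mul_left_comm _ _ _

lemma interaction_eq (hS : ∀ n m, S n ≤ m → K n m = 0) (n : ℕ) :
    interaction H K n = fun _ _ u => ∑ m ∈ Finset.range (S n), K n m * expTerm H m u := by
  funext x y u
  exact finsum_mul_eq_sum_range (hS n) _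

lemma cutInteraction_eq (hS : ∀ n m, S n ≤ m → K n m = 0) {n L : ℕ} (hL : S n ≤ L)
    (u : ℕ →₀ ℝ) :
    cutInteraction H K L u n = ∑ m ∈ Finset.range (S n), K n m * expTerm H m u := by
  symm
  refine Finset.sum_subset (Finset.range_mono hL) fun m _ hm => ?_
  rw [hS n m (by simpa using hm), zero_mul]

/-- On the equation manifold ∑ a_k u_{k,xy} becomes a series in the exponentials with coefficients
(aK)_m. This is how AK enters the symmetry condition. -/
lemma finsum_cutInteraction (hT : ∀ m k, T m ≤ k → K k m = 0) (L : ℕ) (u : ℕ →₀ ℝ)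
    (a : ℕ → ℝ) :
    ∑ᶠ k, cutInteraction H K L u k * a k
      = ∑ m ∈ Finset.range L, (∑ᶠ k, K k m * a k) * expTerm H m u := by
  simp only [cutInteraction]
  rw [finsum_sum_mul_eq (Q := T) (fun m k hk => by rw [hT m k hk, zero_mul])]
  refine Finset.sum_congr rfl fun m _ => ?_
  rw [finsum_mul_eq_sum_range (hT m), finsum_mul_eq_sum_range (R := T m)
    (fun k hk => by rw [hT m k hk, zero_mul]), Finset.sum_mul]
  exact Finset.sum_congr rfl fun k _ => by ring

lemma hasDerivAt_expTerm (m k : ℕ) (u : ℕ →₀ ℝ) :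
    HasDerivAt (fun t => expTerm H m (u + Finsupp.single k t)) (H m k * expTerm H m u) 0 := by
  simp only [expTerm_eq, map_add]
  have h1 : ∀ t, exponent H m (Finsupp.single k t) = t * H m k := fun t => lin_single (H m) k t
  simp only [h1]
  have h2 : HasDerivAt (fun t : ℝ => exponent H m u + t * H m k) (H m k) 0 := by
    simpa using ((hasDerivAt_id (0 : ℝ)).mul_const (H m k)).const_add (exponent H m u)
  have h3 := h2.exp
  simp only [zero_mul, add_zero] at h3
  rw [mul_comm]
  exact h3

lemma du_interaction (hS : ∀ n m, S n ≤ m → K n m = 0) (n k : ℕ) (x y : ℝ) (u : ℕ →₀ ℝ) :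
    du k (interaction H K n) x y u
      = ∑ m ∈ Finset.range (S n), K n m * (H m k * expTerm H m u) := by
  rw [interaction_eq hS]
  exact (HasDerivAt.fun_sum fun m _ =>
    (hasDerivAt_expTerm m k u).const_mul (K n m)).deriv

lemma finsum_du_interaction (hR : ∀ m k, R m ≤ k → H m k = 0)
    (hS : ∀ n m, S n ≤ m → K n m = 0) (n : ℕ) (φ : ℕ → ℝ) (x y : ℝ) (u : ℕ →₀ ℝ) :
    ∑ᶠ k, φ k * du k (interaction H K n) x y u
      = ∑ m ∈ Finset.range (S n), K n m * (∑ᶠ k, H m k * φ k) * expTerm H m u := by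
  simp only [du_interaction hS, mul_comm (φ _)]
  rw [finsum_sum_mul_eq (Q := R) (fun m k hk => by rw [hR m k hk]; ring)]
  refine Finset.sum_congr rfl fun m _ => ?_
  rw [finsum_mul_eq_sum_range (hR m), finsum_mul_eq_sum_range (R := R m)
    (fun k hk => by rw [hR m k hk]; ring), Finset.mul_sum, Finset.sum_mul]
  exact Finset.sum_congr rfl fun k _ => by ring

lemma dx_interaction (n : ℕ) : dx (interaction H K n) = 0 := by
  funext x y u
  simp [dx, interaction]

lemma dy_interaction (n : ℕ) : dy (interaction H K n) = 0 := by
  funext x y u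
  simp [dy, interaction]

lemma totalX_of_x (ξ : ℝ → ℝ) (j : Jet) : totalX (fun x _ _ => ξ x) j = deriv ξ j.x := by
  simp [totalX, dx, du]

lemma totalY_of_x (ξ : ℝ → ℝ) (j : Jet) : totalY (fun x _ _ => ξ x) j = 0 := by
  simp [totalY, dy, du]

lemma totalX_of_y (η : ℝ → ℝ) (j : Jet) : totalX (fun _ y _ => η y) j = 0 := by
  simp [totalX, dx, du]

lemma totalY_of_y (η : ℝ → ℝ) (j : Jet) : totalY (fun _ y _ => η y) j = deriv η j.y := by
  simp [totalY, dy, du]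

lemma totalXY_of_x (ξ : ℝ → ℝ) (j : Jet) : totalXY (fun x _ _ => ξ x) j = 0 := by
  have h : ∀ k, du k (fun x _ _ => ξ x) = fun _ _ _ => 0 := fun k => by funext; simp [du]
  simp only [totalXY, h]
  simp [dx, dy, du]

lemma totalXY_of_y (η : ℝ → ℝ) (j : Jet) : totalXY (fun _ y _ => η y) j = 0 := by
  have h : ∀ k, du k (fun _ y _ => η y) = fun _ _ _ => 0 := fun k => by funext; simp [du]
  simp only [totalXY, h]
  simp [dx, dy, du]

lemma dy_affine (α : ℝ → ℝ → ℝ) (a : ℕ → ℝ) :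
    dy (fun x y u => α x y + lin a u) = fun x y _ => deriv (α x) y := by
  funext x y u
  simp [dy]

lemma totalXY_affine (α : ℝ → ℝ → ℝ) (a : ℕ → ℝ) (j : Jet) :
    totalXY (fun x y u => α x y + lin a u) j
      = deriv (fun x => deriv (α x) j.y) j.x + ∑ᶠ k, j.uxy k * a k := by
  simp only [totalXY, du_affine, dy_affine]
  simp [dx, dy, du]

/-- The prolongation of a field whose `∂_x` and `∂_y` coefficients are functions of `x` and `y`
alone. -/
lemma prolongE_conformal (hR : ∀ m k, R m ≤ k → H m k = 0)
    (hS : ∀ n m, S n ≤ m → K n m = 0) (ξ η : ℝ → ℝ) (φ : ℕ → Coef) (n : ℕ) (j : Jet) :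
    prolongE H K (fun x _ _ => ξ x, fun _ y _ => η y, φ) n j
      = totalXY (φ n) j - (deriv ξ j.x + deriv η j.y) * j.uxy n
        - ∑ m ∈ Finset.range (S n),
            K n m * (∑ᶠ k, H m k * φ k j.x j.y j.u) * expTerm H m j.u := by
  have h := finsum_du_interaction hR hS n (fun k => φ k j.x j.y j.u) j.x j.y j.u
  simp only [prolongE, prolongXY, VectorField.xi, VectorField.eta, VectorField.phi,
    totalXY_of_x, totalXY_of_y, totalX_of_x, totalX_of_y, totalY_of_x, totalY_of_y,
    dx_interaction, dy_interaction, h]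
  simp

/-- The free variable u_{0,xx} occurs only in -(D_y ξ) u_{0,xx}, so D_y ξ = 0; varying u_y in this
identity removes ξ_y and every ξ_{u_k}. -/
lemma xi_eq_of_isSymmetry {v : VectorField} (hv : IsSymmetry H K v) (x y : ℝ) (u : ℕ →₀ ℝ) :
    v.xi x y u = v.xi x 0 0 := by
  have key : ∀ (x y : ℝ) (u uy : ℕ →₀ ℝ), dy v.xi x y u + (uy.sum fun k a => a * du k v.xi x y u) = 0 := by
    intro x y u uy
    have h := (hv.2 0 x y u 0 uy 0 0).sub (hv.2 0 x y u 0 uy (Finsupp.single 0 1) 0)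
    rw [sub_zero] at h
    refine tendsto_nhds_unique (tendsto_const_nhds.congr fun L => ?_) h
    simp only [prolongE, prolongXY, totalXY, totalX, totalY]
    simp
  have hy : ∀ x y u, dy v.xi x y u = 0 := fun x y u => by simpa using key x y u 0
  have hu : ∀ k x y u, du k v.xi x y u = 0 := fun k x y u => by
    simpa [hy] using key x y u (Finsupp.single k 1)
  rw [eq_of_du_eq_zero hv.1.1 (fun k u => hu k x y u) u,
    eq_of_dy_eq_zero hv.1.1 (fun y => hy x y 0) y 0]

lemma eta_eq_of_isSymmetry {v : VectorField} (hv : IsSymmetry H K v) (x y : ℝ) (u : ℕ →₀ ℝ) :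
    v.eta x y u = v.eta 0 y 0 := by
  have key : ∀ (x y : ℝ) (u ux : ℕ →₀ ℝ), dx v.eta x y u + (ux.sum fun k a => a * du k v.eta x y u) = 0 := by
    intro x y u ux
    have h := (hv.2 0 x y u ux 0 0 0).sub (hv.2 0 x y u ux 0 0 (Finsupp.single 0 1))
    rw [sub_zero] at h
    refine tendsto_nhds_unique (tendsto_const_nhds.congr fun L => ?_) h
    simp only [prolongE, prolongXY, totalXY, totalX, totalY]
    simp
  have hx : ∀ x y u, dx v.eta x y u = 0 := fun x y u => by simpa using key x y u 0
  have hu : ∀ k x y u, du k v.eta x y u = 0 := fun k x y u => by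
    simpa [hx] using key x y u (Finsupp.single k 1)
  rw [eq_of_du_eq_zero hv.1.2.1 (fun k u => hu k x y u) u,
    eq_of_dx_eq_zero hv.1.2.1 (fun y => hx y _ 0) x 0]

/-- The coefficients of the `∂_{u_n}` of a symmetry are affine in the fields. -/
lemma phi_affine_of_isSymmetry (hR : ∀ m k, R m ≤ k → H m k = 0)
    (hS : ∀ n m, S n ≤ m → K n m = 0) {ξ η : ℝ → ℝ} {φ : ℕ → Coef}
    (hv : IsSymmetry H K (fun x _ _ => ξ x, fun _ y _ => η y, φ)) (n : ℕ) :
    ∃ a : ℕ → ℝ, φ n = fun x y u => φ n x y 0 + lin a u := by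
  have h := hv.2 n
  simp only [prolongE_conformal hR hS] at h
  have key : ∀ (x y : ℝ) (u ux uy : ℕ →₀ ℝ),
      (uy.sum fun k a => a * dx (du k (φ n)) x y u)
        + (ux.sum fun k a => a * dy (du k (φ n)) x y u)
        + (ux.sum fun k a => uy.sum fun l b => a * b * du k (du l (φ n)) x y u) = 0 := by
    intro x y u ux uy
    -- Subtracting the jet with u_x = u_y = 0 cancels all terms except those containing u_x or u_y;
    -- unit vectors then isolate each second derivative.
    have h := (h x y u ux uy 0 0).sub (h x y u 0 0 0 0)
    rw [sub_zero] at h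
    refine tendsto_nhds_unique (tendsto_const_nhds.congr fun L => ?_) h
    simp only [totalXY]
    simp
    ring
  have hx : ∀ k, dx (du k (φ n)) = 0 := fun k => by
    funext x y u
    simpa using key x y u 0 (Finsupp.single k 1)
  have hy : ∀ k, dy (du k (φ n)) = 0 := fun k => by
    funext x y u
    simpa using key x y u (Finsupp.single k 1) 0
  refine exists_affine (hv.1.2.2 n) hx hy fun k l => ?_
  funext x y u
  simpa [hx, hy] using key x y u (Finsupp.single k 1) (Finsupp.single l 1)

/-- The linear function `u ↦ ∑ k, a k * ∑ l, A k l * u l` vanishes if and only if its coefficients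
do. -/
lemma finsum_lin_eq_zero_iff {a : ℕ → ℝ} {P : ℕ} (ha : ∀ k, P ≤ k → a k = 0) (A : ℕ → ℕ → ℝ) :
    (∑ k ∈ Finset.range P, a k • lin (A k) = 0) ↔ ∀ l, ∑ᶠ k, a k * A k l = 0 := by
  have h : ∀ l, ∑ᶠ k, a k * A k l
      = (∑ k ∈ Finset.range P, a k • lin (A k)) (Finsupp.single l 1) := by
    intro l
    rw [finsum_mul_eq_sum_range ha]
    simp
  simp only [h]
  constructor
  · intro h l
    rw [h]; rfl
  · intro h
    ext l
    simpa using h l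

lemma finsum_mul_affine {a : ℕ → ℝ} {P : ℕ} (ha : ∀ k, P ≤ k → a k = 0) (A : ℕ → ℕ → ℝ)
    (c : ℕ → ℝ) (u : ℕ →₀ ℝ) :
    ∑ᶠ k, a k * (c k + lin (A k) u)
      = ∑ᶠ k, a k * c k + (∑ k ∈ Finset.range P, a k • lin (A k)) u := by
  rw [finsum_mul_eq_sum_range ha, finsum_mul_eq_sum_range ha]
  simp [mul_add, Finset.sum_add_distrib]

variable {C : ℕ → ℕ}

/-- The solution of the determining equations: a field is a symmetry if and only if its
coefficients are `ξ(x)`, `η(y)` and `α_n(x, y) + ∑ k, A n k * u k`, where `H A = 0`, `A K = 0`,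
`H α = -(ξ' + η') (1, 1, …)`, and `α` is the sum of a function of `x` and a function of `y`. -/
theorem isSymmetry_iff (hR : ∀ m k, R m ≤ k → H m k = 0) (hC : ∀ m k, C k ≤ m → H m k = 0)
    (hS : ∀ n m, S n ≤ m → K n m = 0) (hT : ∀ m k, T m ≤ k → K k m = 0)
    (hrows : Function.Injective H) (hrow_ne : ∀ i, H i ≠ 0)
    (hHK : ∀ j, ∃ i, ∑ᶠ l : ℕ, H i l * K l j ≠ 0) (v : VectorField) :
    IsSymmetry H K v ↔
      ∃ (ξ η : ℝ → ℝ) (α : ℕ → ℝ → ℝ → ℝ) (A : ℕ → ℕ → ℝ),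
        ContDiff ℝ ∞ ξ ∧ ContDiff ℝ ∞ η ∧ (∀ n, ContDiff ℝ ∞ (Function.uncurry (α n))) ∧
        v = (fun x _ _ => ξ x, fun _ y _ => η y, fun n x y u => α n x y + lin (A n) u) ∧
        (∀ n x y, α n x y = α n x 0 + α n 0 y - α n 0 0) ∧
        (∀ m x y, ∑ᶠ k, H m k * α k x y = -(deriv ξ x + deriv η y)) ∧
        (∀ m l, ∑ᶠ k, H m k * A k l = 0) ∧ (∀ m n, ∑ᶠ k, K k m * A n k = 0) := by
  constructor
  · intro hv
    set ξ : ℝ → ℝ := fun x => v.xi x 0 0 with hξ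
    set η : ℝ → ℝ := fun y => v.eta 0 y 0 with hη
    set α : ℕ → ℝ → ℝ → ℝ := fun n x y => v.phi n x y 0 with hα
    have hv1 : v = (fun x _ _ => ξ x, fun _ y _ => η y, v.phi) := by
      refine Prod.ext ?_ (Prod.ext ?_ rfl)
      · funext x y u
        exact xi_eq_of_isSymmetry hv x y u
      · funext x y u
        exact eta_eq_of_isSymmetry hv x y u
    have hv2 := hv
    rw [hv1] at hv2
    choose A hA using phi_affine_of_isSymmetry hR hS hv2
    have hphi : v.phi = fun n x y u => α n x y + lin (A n) u := funext hA
    have hv3 : v = (fun x _ _ => ξ x, fun _ y _ => η y,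
        fun n x y u => α n x y + lin (A n) u) := by rw [← hphi]; exact hv1
    have hsmooth : ∀ n, ContDiff ℝ ∞ (Function.uncurry (α n)) := fun n =>
      contDiff_zero_fields (hv.1.2.2 n)
    have hlim := hv.2
    rw [hv3] at hlim
    simp only [prolongE_conformal hR hS, totalXY_affine, finsum_cutInteraction hT] at hlim
    -- Coefficients of the symmetry condition, read as a series: the part constant in u, the part
    -- linear in u (finitely many m, since row n of K is finite), and the term -α_{xy} without an
    -- exponential.
    have hcoeff : ∀ n x y, (∀ m, ∑ᶠ k, K k m * A n k
          - K n m * (deriv ξ x + deriv η y + ∑ᶠ k, H m k * α k x y) = 0) ∧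
        (∀ m, K n m • ∑ k ∈ Finset.range (R m), H m k • lin (A k) = 0) ∧
        -deriv (fun x => deriv (α n x) y) x = 0 := by
      intro n x y
      refine coeff_eq_zero_of_tendsto hC hrows hrow_ne _ _ (S n) (fun m hm => by
        rw [hS n m hm, zero_smul]) _ fun u => ?_
      have h := (hlim n x y u 0 0 0 0).add_const (-deriv (fun x => deriv (α n x) y) x
        + ∑ m ∈ Finset.range (S n), (K n m • ∑ k ∈ Finset.range (R m), H m k • lin (A k)) u
          * expTerm H m u)
      rw [zero_add] at h
      refine h.congr' ?_
      filter_upwards [eventually_ge_atTop (S n)] with L hL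
      have e1 : ∑ m ∈ Finset.range L, K n m * (deriv ξ x + deriv η y
            + ∑ᶠ k, H m k * α k x y) * expTerm H m u
          = ∑ m ∈ Finset.range (S n), K n m * (deriv ξ x + deriv η y
            + ∑ᶠ k, H m k * α k x y) * expTerm H m u := by
        symm
        refine Finset.sum_subset (Finset.range_mono hL) fun m _ hm => ?_
        rw [hS n m (by simpa using hm)]
        ring
      simp only [cutInteraction_eq hS hL, finsum_mul_affine (hR _), sub_mul,
        Finset.sum_sub_distrib, e1]
      simp only [mul_add, add_mul, Finset.sum_add_distrib, Finset.mul_sum, LinearMap.smul_apply,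
        smul_eq_mul]
      have e2 : ∀ s : ℝ, ∑ m ∈ Finset.range (S n), K n m * s * expTerm H m u
          = ∑ m ∈ Finset.range (S n), s * (K n m * expTerm H m u) := fun s =>
        Finset.sum_congr rfl fun m _ => by ring
      simp only [e2]
      ring
    have hK : ∀ m, ∃ n, K n m ≠ 0 := by
      intro m
      by_contra! hm
      obtain ⟨i, hi⟩ := hHK m
      exact hi (by simp [hm])
    have hHA : ∀ m l, ∑ᶠ k, H m k * A k l = 0 := by
      intro m
      obtain ⟨n, hn⟩ := hK m
      exact (finsum_lin_eq_zero_iff (hR m) A).1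
        ((smul_eq_zero.1 ((hcoeff n 0 0).2.1 m)).resolve_left hn)
    have hHα : ∀ m x y, deriv ξ x + deriv η y + ∑ᶠ k, H m k * α k x y = 0 := by
      intro m x y
      obtain ⟨i, hi⟩ := hHK m
      -- H(AK) = (HA)K = 0, while the coefficient identity makes the left side (HK)_{im} times the
      -- scalar to be shown zero; i is chosen with (HK)_{im} ≠ 0.
      have h1 : ∑ᶠ n, H i n * ∑ᶠ k, K k m * A n k = 0 := by
        rw [finsum_mul_finsum_comm (hR i) (hT m)]
        simp [hHA]
      have h2 : ∀ n, ∑ᶠ k, K k m * A n k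
          = K n m * (deriv ξ x + deriv η y + ∑ᶠ k, H m k * α k x y) := fun n =>
        sub_eq_zero.1 ((hcoeff n x y).1 m)
      simp only [h2] at h1
      rw [finsum_mul_eq_sum_range (hR i)] at h1 hi
      simp only [← mul_assoc, ← Finset.sum_mul] at h1
      exact (mul_eq_zero.1 h1).resolve_left hi
    refine ⟨ξ, η, α, A, hv.1.1.comp_const contDiff_id contDiff_const 0,
      hv.1.2.1.comp_const contDiff_const contDiff_id 0, hsmooth, hv3, fun n => ?_,
      fun m x y => by linarith [hHα m x y], hHA, fun m n => ?_⟩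
    · refine eq_add_of_dx_dy_eq_zero (hv.1.2.2 n) 0 fun x y => ?_
      rw [hphi]
      simp only [dy_affine]
      exact neg_eq_zero.1 (hcoeff n x y).2.2
    · have := (hcoeff n 0 0).1 m
      rw [hHα] at this
      linarith
  · rintro ⟨ξ, η, α, A, hξ, hη, hα, rfl, hsum, hHα, hHA, hAK⟩
    refine ⟨⟨fun n => ?_, fun n => ?_, fun n => smoothCoef_affine (hα n) _⟩, ?_⟩
    · exact hξ.comp contDiff_fst
    · exact hη.comp (contDiff_fst.comp contDiff_snd)
    · intro n x y u ux uy uxx uyy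
      simp only [prolongE_conformal hR hS, totalXY_affine, finsum_cutInteraction hT]
      refine tendsto_const_nhds.congr' ?_
      filter_upwards [eventually_ge_atTop (S n)] with L hL
      have h1 : (fun x => deriv (α n x) y) = fun _ => deriv (α n 0) y := by
        funext x
        have : α n x = fun y => (α n x 0 - α n 0 0) + α n 0 y := by
          funext y
          rw [hsum n x y]
          ring
        rw [this, deriv_const_add]
      have h2 : ∀ m, ∑ k ∈ Finset.range (R m), H m k • lin (A k) = 0 := fun m =>
        (finsum_lin_eq_zero_iff (hR m) A).2 (hHA m)
      simp only [cutInteraction_eq hS hL, finsum_mul_affine (hR _), h1, h2, hAK, hHα,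
        deriv_const, Finset.mul_sum, zero_mul, Finset.sum_const_zero, LinearMap.zero_apply,
        add_zero, zero_sub, ← Finset.sum_neg_distrib, ← Finset.sum_sub_distrib]
      symm
      exact Finset.sum_eq_zero fun m _ => by ring

end Determining

/-! ### The generators as explicit fields -/

section Classification

variable {M N M' N' : ℕ} {p₁ p₂ q₁ q₂ : ℤ} {H K : ℕ → ℕ → ℝ}

theorem IsSemiBandRows.isSymmetry_iff (hH : IsSemiBandRows M N p₁ p₂ H)
    (hK : IsSemiBandColumns M' N' q₁ q₂ K) (hrows : Function.Injective H)
    (hrow_ne : ∀ i, H i ≠ 0) (hHK : ∀ j, ∃ i, ∑ᶠ l : ℕ, H i l * K l j ≠ 0) (v : VectorField) :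
    IsSymmetry H K v ↔
      ∃ (ξ η : ℝ → ℝ) (α : ℕ → ℝ → ℝ → ℝ) (A : ℕ → ℕ → ℝ),
        ContDiff ℝ ∞ ξ ∧ ContDiff ℝ ∞ η ∧ (∀ n, ContDiff ℝ ∞ (Function.uncurry (α n))) ∧
        v = (fun x _ _ => ξ x, fun _ y _ => η y, fun n x y u => α n x y + lin (A n) u) ∧
        (∀ n x y, α n x y = α n x 0 + α n 0 y - α n 0 0) ∧
        (∀ m x y, ∑ᶠ k, H m k * α k x y = -(deriv ξ x + deriv η y)) ∧
        (∀ m l, ∑ᶠ k, H m k * A k l = 0) ∧ (∀ m n, ∑ᶠ k, K k m * A n k = 0) := by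
  obtain ⟨R, hR⟩ := hH.exists_rowBound
  obtain ⟨C, hC⟩ := hH.exists_columnBound
  obtain ⟨T, hT⟩ := IsSemiBandRows.exists_rowBound hK
  obtain ⟨S, hS⟩ := IsSemiBandRows.exists_columnBound hK
  exact Toda.isSymmetry_iff hR hC (fun n m h => hS m n h) hT hrows hrow_ne hHK v

lemma lin_sum_sum {n m : ℕ} (q : Fin n → Fin m → ℝ) (χ : Fin n → ℝ) (φ : Fin m → ℕ → ℝ)
    (u : ℕ →₀ ℝ) :
    lin (fun k => ∑ j, ∑ l, q j l * (χ j * φ l k)) u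
      = ∑ j, ∑ l, q j l * (lin (φ l) u * χ j) := by
  have : lin (fun k => ∑ j, ∑ l, q j l * (χ j * φ l k))
      = ∑ j, ∑ l, (q j l * χ j) • lin (φ l) := by
    ext k
    simp [mul_assoc]
  rw [this]
  simp only [LinearMap.sum_apply, LinearMap.smul_apply, smul_eq_mul]
  exact Finset.sum_congr rfl fun j _ => Finset.sum_congr rfl fun l _ => by ring

lemma conformal_field_eq {n m : ℕ} (b : ℕ → ℝ) (ξ η : ℝ → ℝ) (r s : Fin n → ℝ → ℝ)
    (q : Fin n → Fin m → ℝ) (χ : Fin n → ℕ → ℝ) (φ : Fin m → ℕ → ℝ) :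
    genX b ξ + genY b η + ∑ j, genU (χ j) (r j) + ∑ j, genV (χ j) (s j)
        + ∑ j, ∑ l, q j l • genZ (χ j) (φ l)
      = (fun x _ _ => ξ x, fun _ y _ => η y, fun n x y u =>
          (-((deriv ξ x + deriv η y) * b n) + ∑ j, (r j x + s j y) * χ j n)
            + lin (fun k => ∑ j, ∑ l, q j l * (χ j n * φ l k)) u) := by
  refine Prod.ext ?_ (Prod.ext ?_ ?_)
  · funext x y u
    simp [genX, genY, genU, genV, genZ, Prod.fst_sum]
  · funext x y u
    simp [genX, genY, genU, genV, genZ, Prod.fst_sum, Prod.snd_sum]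
  · funext n x y u
    simp only [lin_sum_sum, genX, genY, genU, genV, genZ, Prod.snd_sum, Prod.snd_add,
      Prod.smul_snd, Pi.add_apply, Finset.sum_apply, Pi.smul_apply, smul_eq_mul, sum_eq_lin,
      add_mul, Finset.sum_add_distrib]
    ring

lemma poincare_field_eq {n m : ℕ} (a₁ a₂ c : ℝ) (r s : Fin n → ℝ → ℝ)
    (q : Fin n → Fin m → ℝ) (χ : Fin n → ℕ → ℝ) (φ : Fin m → ℕ → ℝ) :
    a₁ • genP₁ + a₂ • genP₂ + c • genL + ∑ j, genU (χ j) (r j) + ∑ j, genV (χ j) (s j)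
        + ∑ j, ∑ l, q j l • genZ (χ j) (φ l)
      = (fun x _ _ => a₁ + c * x, fun _ y _ => a₂ - c * y, fun n x y u =>
          (∑ j, (r j x + s j y) * χ j n)
            + lin (fun k => ∑ j, ∑ l, q j l * (χ j n * φ l k)) u) := by
  refine Prod.ext ?_ (Prod.ext ?_ ?_)
  · funext x y u
    simp [genP₁, genP₂, genL, genU, genV, genZ, Prod.fst_sum]
  · funext x y u
    simp [genP₁, genP₂, genL, genU, genV, genZ, Prod.fst_sum, Prod.snd_sum, sub_eq_add_neg]
  · funext n x y u
    simp only [lin_sum_sum, genP₁, genP₂, genL, genU, genV, genZ, Prod.snd_sum, Prod.snd_add,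
      Prod.smul_snd, Pi.add_apply, Finset.sum_apply, Pi.smul_apply, smul_eq_mul, sum_eq_lin,
      add_mul, Finset.sum_add_distrib, Pi.zero_apply, mul_zero, zero_add]

lemma gauge_field_eq {n : ℕ} (r s : Fin n → ℝ → ℝ) (χ : Fin n → ℕ → ℝ) :
    ∑ j, genU (χ j) (r j) + ∑ j, genV (χ j) (s j)
      = (0, 0, fun n x y _ => ∑ j, (r j x + s j y) * χ j n) := by
  refine Prod.ext ?_ (Prod.ext ?_ ?_)
  · funext x y u
    simp [genU, genV, Prod.fst_sum]
  · funext x y u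
    simp [genU, genV, Prod.fst_sum, Prod.snd_sum]
  · funext n x y u
    simp only [genU, genV, Prod.snd_sum, Prod.snd_add, Pi.add_apply, Finset.sum_apply, add_mul,
      Finset.sum_add_distrib]

/-- The field `∑ n, (∑ m, A n m * u m) ∂_{u_n}`. -/
def linearField (A : ℕ → ℕ → ℝ) : VectorField := (0, 0, fun n _ _ u => lin (A n) u)

lemma isLinearField_iff {v : VectorField} : IsLinearField v ↔ ∃ A, v = linearField A := by
  simp only [IsLinearField, linearField, sum_eq_lin]

lemma sum_genZ_eq {n m : ℕ} (g : Fin n × Fin m → ℝ) (χ : Fin n → ℕ → ℝ) (φ : Fin m → ℕ → ℝ) :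
    ∑ t, g t • genZ (χ t.1) (φ t.2)
      = linearField fun n k => ∑ j, ∑ l, g (j, l) * (χ j n * φ l k) := by
  rw [Fintype.sum_prod_type]
  refine Prod.ext ?_ (Prod.ext ?_ ?_)
  · funext x y u
    simp [genZ, linearField, Prod.fst_sum]
  · funext x y u
    simp [genZ, linearField, Prod.fst_sum, Prod.snd_sum]
  · funext n x y u
    simp only [linearField, lin_sum_sum, genZ, Prod.snd_sum, Prod.smul_snd, Finset.sum_apply,
      Pi.smul_apply, smul_eq_mul, sum_eq_lin]

lemma linearField_injective : Function.Injective linearField := by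
  intro A B h
  funext n m
  have := congrFun (congrFun (congrFun (congrFun (congrArg (fun v => v.2.2) h) n) 0) 0)
    (Finsupp.single m 1)
  simpa [linearField, lin_single] using this

/-! ### Symmetries in terms of bases of the two kernels -/

section Basis

variable {n₀ m₀ : ℕ} {χ : Fin n₀ → ℕ → ℝ} {φ : Fin m₀ → ℕ → ℝ}

lemma finsum_mul_add
    (hH : IsSemiBandRows M N p₁ p₂ H)
    (i : ℕ) (B B' : ℕ → ℝ) :
    ∑ᶠ k, H i k * (B k + B' k) = ∑ᶠ k, H i k * B k + ∑ᶠ k, H i k * B' k := by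
  obtain ⟨R, hR⟩ := hH.exists_rowBound
  simp only [finsum_mul_eq_sum_range (hR i)]
  simp only [mul_add, Finset.sum_add_distrib]

lemma finsum_mul_const_mul
    (hH : IsSemiBandRows M N p₁ p₂ H)
    (i : ℕ) (c : ℝ) (B : ℕ → ℝ) :
    ∑ᶠ k, H i k * (c * B k) = c * ∑ᶠ k, H i k * B k := by
  obtain ⟨R, hR⟩ := hH.exists_rowBound
  simp only [finsum_mul_eq_sum_range (hR i)]
  simp only [mul_left_comm _ c, Finset.mul_sum]

lemma finsum_mul_combination
    (hH : IsSemiBandRows M N p₁ p₂ H)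
    (hspan : Submodule.span ℝ (Set.range χ) = kernel hH)
    (c : Fin n₀ → ℝ) (i : ℕ) : ∑ᶠ k, H i k * ∑ j, c j * χ j k = 0 := by
  have h : ∑ j, c j • χ j ∈ kernel hH := by
    rw [← hspan]
    exact Submodule.sum_mem _ fun j _ => Submodule.smul_mem _ _ (Submodule.subset_span ⟨j, rfl⟩)
  simpa using h i

lemma combination_eq_zero (hχ : LinearIndependent ℝ χ) {c : Fin n₀ → ℝ}
    (h : ∀ n, ∑ j, c j * χ j n = 0) (j : Fin n₀) : c j = 0 :=
  Fintype.linearIndependent_iff.1 hχ c (funext fun n => by simpa using h n) j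

lemma exists_combination
    (hH : IsSemiBandRows M N p₁ p₂ H)
    (hspan : Submodule.span ℝ (Set.range χ) = kernel hH) {B : ℕ → ℝ}
    (hB : ∀ i, ∑ᶠ k, H i k * B k = 0) : ∃ c : Fin n₀ → ℝ, ∀ n, B n = ∑ j, c j * χ j n := by
  have hB' : B ∈ Submodule.span ℝ (Set.range χ) := by rw [hspan]; exact hB
  obtain ⟨c, hc⟩ := (Submodule.mem_span_range_iff_exists_fun ℝ).1 hB'
  exact ⟨c, fun n => by rw [← hc]; simp⟩

/-- The matrices `A` with `H A = 0` and `A K = 0` are the combinations of the products of the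
basis elements. -/
lemma matrix_iff
    (hH : IsSemiBandRows M N p₁ p₂ H) (hK : IsSemiBandColumns M' N' q₁ q₂ K)
    (hχ : LinearIndependent ℝ χ)
    (hχspan : Submodule.span ℝ (Set.range χ) = kernel hH)
    (hφspan : Submodule.span ℝ (Set.range φ) = kernel hK) (A : ℕ → ℕ → ℝ) :
    ((∀ m l, ∑ᶠ k, H m k * A k l = 0) ∧ (∀ m n, ∑ᶠ k, K k m * A n k = 0)) ↔
      ∃ q : Fin n₀ → Fin m₀ → ℝ, A = fun n k => ∑ j, ∑ l, q j l * (χ j n * φ l k) := by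
  constructor
  · rintro ⟨h1, h2⟩
    choose c hc using fun l => exists_combination hH hχspan (B := fun n => A n l) fun m => h1 m l
    -- The columns of A are expanded in the χ^j; by their independence AK = 0 passes to the
    -- coefficient sequences k ↦ c k j, which are expanded in the φ^l in turn.
    have h3 : ∀ j m, ∑ᶠ k, K k m * c k j = 0 := by
      intro j m
      obtain ⟨T, hT⟩ := IsSemiBandRows.exists_rowBound hK
      refine combination_eq_zero hχ (c := fun j => ∑ᶠ k, K k m * c k j) (fun n => ?_) j
      rw [← h2 m n]
      simp only [finsum_mul_eq_sum_range (hT m)]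
      simp only [hc, Finset.mul_sum, Finset.sum_mul]
      rw [Finset.sum_comm]
      simp only [mul_assoc]
    choose q hq using fun j => exists_combination hK hφspan (B := fun k => c k j) (h3 j)
    refine ⟨q, funext fun n => funext fun k => ?_⟩
    rw [hc]
    refine Finset.sum_congr rfl fun j _ => ?_
    rw [hq, Finset.sum_mul]
    exact Finset.sum_congr rfl fun l _ => by ring
  · rintro ⟨q, rfl⟩
    refine ⟨fun m l => ?_, fun m n => ?_⟩
    · rw [← finsum_mul_combination hH hχspan (fun j => ∑ i, q j i * φ i l) m]
      simp only [Finset.sum_mul, mul_assoc, mul_comm (χ _ _)]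
    · rw [← finsum_mul_combination hK hφspan (fun l => ∑ j, q j l * χ j n) m]
      refine finsum_congr fun k => ?_
      beta_reduce
      rw [Finset.sum_comm]
      simp only [Finset.sum_mul, mul_assoc]

/-- Smooth solutions of `H α = 0` that are sums of functions of `x` and of `y`. -/
lemma gauge_iff
    (hH : IsSemiBandRows M N p₁ p₂ H)
    (hχ : LinearIndependent ℝ χ)
    (hχspan : Submodule.span ℝ (Set.range χ) = kernel hH) (α : ℕ → ℝ → ℝ → ℝ) :
    ((∀ n, ContDiff ℝ ∞ (Function.uncurry (α n))) ∧
        (∀ n x y, α n x y = α n x 0 + α n 0 y - α n 0 0) ∧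
        (∀ m x y, ∑ᶠ k, H m k * α k x y = 0)) ↔
      ∃ r s : Fin n₀ → ℝ → ℝ, (∀ j, ContDiff ℝ ∞ (r j)) ∧ (∀ j, ContDiff ℝ ∞ (s j)) ∧
        α = fun n x y => ∑ j, (r j x + s j y) * χ j n := by
  constructor
  · rintro ⟨h1, h2, h3⟩
    obtain ⟨J, g, hg⟩ := hH.exists_coordinates hχ hχspan
    have hg' : ∀ j, ContDiff ℝ ∞ fun w => g w j := fun j =>
      (contDiff_apply ℝ ℝ j).comp (LinearMap.toContinuousLinearMap g).contDiff
    -- The coordinates of α(x,0) and of α(0,y) - α(0,0), following the splitting of α; the constant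
    -- goes to s.
    refine ⟨fun j x => g (fun i => α i x 0) j, fun j y => g (fun i => α i 0 y) j
      - g (fun i => α i 0 0) j, fun j => ?_, fun j => ?_, ?_⟩
    · refine (hg' j).comp (contDiff_pi.2 fun i => ?_)
      exact (h1 i).comp (contDiff_id.prodMk contDiff_const)
    · refine ContDiff.sub ((hg' j).comp (contDiff_pi.2 fun i => ?_)) contDiff_const
      exact (h1 i).comp (contDiff_const.prodMk contDiff_id)
    · funext n x y
      have e : ∀ x y, α n x y = ∑ j, g (fun i => α i x y) j * χ j n := fun x y => by
        have := congrFun (hg (fun n => α n x y) fun m => h3 m x y) n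
        simpa [firstTerms, LinearMap.funLeft, Function.comp_def] using this
      rw [h2 n x y, e x 0, e 0 y, e 0 0, ← Finset.sum_add_distrib, ← Finset.sum_sub_distrib]
      exact Finset.sum_congr rfl fun j _ => by ring
  · rintro ⟨r, s, hr, hs, rfl⟩
    refine ⟨fun n => ?_, fun n x y => ?_, fun m x y => ?_⟩
    · exact ContDiff.sum fun j _ => ((((hr j).comp contDiff_fst).add
        ((hs j).comp contDiff_snd)).mul contDiff_const)
    · rw [← Finset.sum_add_distrib, ← Finset.sum_sub_distrib]
      exact Finset.sum_congr rfl fun j _ => by ring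
    · exact finsum_mul_combination hH hχspan (fun j => r j x + s j y) m

lemma contDiff_deriv {f : ℝ → ℝ} (hf : ContDiff ℝ ∞ f) : ContDiff ℝ ∞ (deriv f) :=
  (contDiff_infty_iff_deriv.1 hf).2

/-- The symmetries, if `H b = (1, 1, …)` has a solution. -/
theorem isSymmetry_iff_conformal
    (hH : IsSemiBandRows M N p₁ p₂ H) (hK : IsSemiBandColumns M' N' q₁ q₂ K)
    (hrows : Function.Injective H) (hrow_ne : ∀ i, H i ≠ 0)
    (hHK : ∀ j, ∃ i, ∑ᶠ l : ℕ, H i l * K l j ≠ 0)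
    (hχ : LinearIndependent ℝ χ)
    (hχspan : Submodule.span ℝ (Set.range χ) = kernel hH)
    (hφspan : Submodule.span ℝ (Set.range φ) = kernel hK) {b : ℕ → ℝ}
    (hb : ∀ i, ∑ᶠ k, H i k * b k = 1) (v : VectorField) :
    IsSymmetry H K v ↔
      ∃ (ξ η : ℝ → ℝ) (r s : Fin n₀ → ℝ → ℝ) (q : Fin n₀ → Fin m₀ → ℝ),
        ContDiff ℝ ∞ ξ ∧ ContDiff ℝ ∞ η ∧
        (∀ j, ContDiff ℝ ∞ (r j)) ∧ (∀ j, ContDiff ℝ ∞ (s j)) ∧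
        v = genX b ξ + genY b η + ∑ j, genU (χ j) (r j) + ∑ j, genV (χ j) (s j)
          + ∑ j, ∑ l, q j l • genZ (χ j) (φ l) := by
  simp only [conformal_field_eq]
  have hsm : ∀ {ξ η : ℝ → ℝ}, ContDiff ℝ ∞ ξ → ContDiff ℝ ∞ η → ∀ n, ContDiff ℝ ∞
      (Function.uncurry fun x y => (deriv ξ x + deriv η y) * b n) := fun hξ hη n =>
    (((contDiff_deriv hξ).comp contDiff_fst).add
      ((contDiff_deriv hη).comp contDiff_snd)).mul contDiff_const
  rw [hH.isSymmetry_iff hK hrows hrow_ne hHK]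
  constructor
  · rintro ⟨ξ, η, α, A, hξ, hη, hα, rfl, hsum, hHα, hA⟩
    obtain ⟨q, rfl⟩ := (matrix_iff hH hK hχ hχspan hφspan A).1 hA
    -- Removing the particular solution -(ξ' + η')b leaves a solution of the homogeneous system.
    obtain ⟨r, s, hr, hs, hrs⟩ := (gauge_iff hH hχ hχspan
      (fun n x y => α n x y + (deriv ξ x + deriv η y) * b n)).1
      ⟨fun n => (hα n).add (hsm hξ hη n), fun n x y => by rw [hsum n x y]; ring,
        fun m x y => by
          rw [finsum_mul_add hH m (fun k => α k x y), hHα, finsum_mul_const_mul hH, hb]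
          ring⟩
    refine ⟨ξ, η, r, s, q, hξ, hη, hr, hs, ?_⟩
    refine Prod.ext rfl (Prod.ext rfl ?_)
    funext n x y u
    have := congrFun (congrFun (congrFun hrs n) x) y
    beta_reduce at this
    change α n x y + _ = -((deriv ξ x + deriv η y) * b n) + ∑ j, (r j x + s j y) * χ j n + _
    rw [← this]
    ring
  · rintro ⟨ξ, η, r, s, q, hξ, hη, hr, hs, rfl⟩
    obtain ⟨h1, h2, h3⟩ := (gauge_iff hH hχ hχspan _).2 ⟨r, s, hr, hs, rfl⟩
    refine ⟨ξ, η, fun n x y => -((deriv ξ x + deriv η y) * b n) + ∑ j, (r j x + s j y) * χ j n, _,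
      hξ, hη, fun n => (hsm hξ hη n).neg.add (h1 n), rfl, fun n x y => ?_,
      fun m x y => ?_, (matrix_iff hH hK hχ hχspan hφspan _).2 ⟨q, rfl⟩⟩
    · beta_reduce
      rw [h2 n x y]
      ring
    · rw [finsum_mul_add hH m (fun k => -((deriv ξ x + deriv η y) * b k)), h3]
      simp only [← neg_mul]
      rw [finsum_mul_const_mul hH, hb]
      ring

lemma eq_affine_of_deriv_eq {f : ℝ → ℝ} (hf : ContDiff ℝ ∞ f) {c : ℝ}
    (h : ∀ x, deriv f x = c) (x : ℝ) : f x = f 0 + c * x := by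
  have hd : Differentiable ℝ f := hf.differentiable (by simp)
  have := is_const_of_deriv_eq_zero (f := fun x => f x - c * x) (hd.sub (by fun_prop))
    (fun x => by
      rw [deriv_fun_sub (hd x) (by fun_prop), h]
      simp) x 0
  simp only [mul_zero, sub_zero] at this
  linarith

/-- The symmetries, if `H b = (1, 1, …)` has no solution. -/
theorem isSymmetry_iff_poincare
    (hH : IsSemiBandRows M N p₁ p₂ H) (hK : IsSemiBandColumns M' N' q₁ q₂ K)
    (hrows : Function.Injective H) (hrow_ne : ∀ i, H i ≠ 0)
    (hHK : ∀ j, ∃ i, ∑ᶠ l : ℕ, H i l * K l j ≠ 0)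
    (hχ : LinearIndependent ℝ χ)
    (hχspan : Submodule.span ℝ (Set.range χ) = kernel hH)
    (hφspan : Submodule.span ℝ (Set.range φ) = kernel hK)
    (hb : ¬∃ b : ℕ → ℝ, ∀ i, ∑ᶠ k, H i k * b k = 1) (v : VectorField) :
    IsSymmetry H K v ↔
      ∃ (a₁ a₂ c : ℝ) (r s : Fin n₀ → ℝ → ℝ) (q : Fin n₀ → Fin m₀ → ℝ),
        (∀ j, ContDiff ℝ ∞ (r j)) ∧ (∀ j, ContDiff ℝ ∞ (s j)) ∧
        v = a₁ • genP₁ + a₂ • genP₂ + c • genL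
          + ∑ j, genU (χ j) (r j) + ∑ j, genV (χ j) (s j)
          + ∑ j, ∑ l, q j l • genZ (χ j) (φ l) := by
  simp only [poincare_field_eq]
  rw [hH.isSymmetry_iff hK hrows hrow_ne hHK]
  constructor
  · rintro ⟨ξ, η, α, A, hξ, hη, hα, rfl, hsum, hHα, hA⟩
    obtain ⟨q, rfl⟩ := (matrix_iff hH hK hχ hχspan hφspan A).1 hA
    have h0 : ∀ x y, deriv ξ x + deriv η y = 0 := by
      intro x y
      by_contra hne
      -- At a point where ξ' + η' ≠ 0, rescaling α would solve Hb = (1,1,…). So ξ' and -η' are one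
      -- and the same constant.
      refine hb ⟨fun k => -(deriv ξ x + deriv η y)⁻¹ * α k x y, fun i => ?_⟩
      rw [finsum_mul_const_mul hH, hHα, neg_mul_neg, inv_mul_cancel₀ hne]
    obtain ⟨r, s, hr, hs, rfl⟩ := (gauge_iff hH hχ hχspan α).1
      ⟨hα, hsum, fun m x y => by rw [hHα, h0, neg_zero]⟩
    refine ⟨ξ 0, η 0, deriv ξ 0, r, s, q, hr, hs, ?_⟩
    refine Prod.ext ?_ (Prod.ext ?_ rfl)
    · funext x y u
      exact eq_affine_of_deriv_eq hξ (fun x => by linarith [h0 x 0, h0 0 0]) x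
    · funext x y u
      have := eq_affine_of_deriv_eq hη (c := -deriv ξ 0) (fun y => by linarith [h0 0 y]) y
      simp only [this]
      ring
  · rintro ⟨a₁, a₂, c, r, s, q, hr, hs, rfl⟩
    obtain ⟨h1, h2, h3⟩ := (gauge_iff hH hχ hχspan _).2 ⟨r, s, hr, hs, rfl⟩
    refine ⟨fun x => a₁ + c * x, fun y => a₂ - c * y, _, _, by fun_prop, by fun_prop, h1, rfl, h2,
      fun m x y => ?_, (matrix_iff hH hK hχ hχspan hφspan _).2 ⟨q, rfl⟩⟩
    rw [h3]
    simp

theorem isSymmetry_linearField_iff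
    (hH : IsSemiBandRows M N p₁ p₂ H) (hK : IsSemiBandColumns M' N' q₁ q₂ K)
    (hrows : Function.Injective H) (hrow_ne : ∀ i, H i ≠ 0)
    (hHK : ∀ j, ∃ i, ∑ᶠ l : ℕ, H i l * K l j ≠ 0)
    (A : ℕ → ℕ → ℝ) :
    IsSymmetry H K (linearField A) ↔
      (∀ m l, ∑ᶠ k, H m k * A k l = 0) ∧ (∀ m n, ∑ᶠ k, K k m * A n k = 0) := by
  rw [hH.isSymmetry_iff hK hrows hrow_ne hHK]
  constructor
  · rintro ⟨ξ, η, α, A', -, -, -, hv, -, -, hA⟩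
    have h1 : ∀ n x y u, lin (A n) u = α n x y + lin (A' n) u := fun n x y u =>
      congrFun (congrFun (congrFun (congrFun (congrArg (fun v => v.2.2) hv) n) x) y) u
    have h2 : A = A' := by
      funext n m
      have e1 := h1 n 0 0 0
      have e2 := h1 n 0 0 (Finsupp.single m 1)
      simp only [map_zero, add_zero, lin_single, one_mul] at e1 e2
      rw [e2, ← e1, zero_add]
    rw [h2]
    exact hA
  · rintro hA
    refine ⟨fun _ => 0, fun _ => 0, fun _ _ _ => 0, A, contDiff_const, contDiff_const,
      fun n => contDiff_const, ?_, fun n x y => by simp, fun m x y => by simp, hA⟩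
    refine Prod.ext rfl (Prod.ext rfl ?_)
    funext n x y u
    simp [linearField]

theorem isSymmetry_and_isLinearField_iff
    (hH : IsSemiBandRows M N p₁ p₂ H) (hK : IsSemiBandColumns M' N' q₁ q₂ K)
    (hrows : Function.Injective H) (hrow_ne : ∀ i, H i ≠ 0)
    (hHK : ∀ j, ∃ i, ∑ᶠ l : ℕ, H i l * K l j ≠ 0)
    (hχ : LinearIndependent ℝ χ)
    (hχspan : Submodule.span ℝ (Set.range χ) = kernel hH)
    (hφspan : Submodule.span ℝ (Set.range φ) = kernel hK) (v : VectorField) :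
    IsSymmetry H K v ∧ IsLinearField v ↔
      v ∈ Submodule.span ℝ (Set.range fun t : Fin n₀ × Fin m₀ => genZ (χ t.1) (φ t.2)) := by
  rw [Submodule.mem_span_range_iff_exists_fun, isLinearField_iff]
  simp only [sum_genZ_eq]
  constructor
  · rintro ⟨hv, A, rfl⟩
    obtain ⟨q, rfl⟩ := (matrix_iff hH hK hχ hχspan hφspan A).1
      ((isSymmetry_linearField_iff hH hK hrows hrow_ne hHK A).1 hv)
    exact ⟨fun t => q t.1 t.2, rfl⟩
  · rintro ⟨g, rfl⟩
    exact ⟨(isSymmetry_linearField_iff hH hK hrows hrow_ne hHK _).2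
      ((matrix_iff hH hK hχ hχspan hφspan _).2 ⟨fun j l => g (j, l), rfl⟩), _, rfl⟩

/-- The underlying matrices are the products χ^j_n φ^l_k: independence of the χ^j is used at each
fixed k, then that of the φ^l. -/
theorem linearIndependent_genZ (hχ : LinearIndependent ℝ χ) (hφ : LinearIndependent ℝ φ) :
    LinearIndependent ℝ (fun t : Fin n₀ × Fin m₀ => genZ (χ t.1) (φ t.2)) := by
  rw [Fintype.linearIndependent_iff]
  intro g hg
  rw [sum_genZ_eq] at hg
  have h0 : (0 : VectorField) = linearField 0 := by
    refine Prod.ext rfl (Prod.ext rfl ?_)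
    funext n x y u
    change (0 : ℝ) = lin (fun _ => 0) u
    simp [lin, Finsupp.linearCombination_apply]
  have h1 := linearField_injective (hg.trans h0)
  have h2 : ∀ k j, ∑ l, g (j, l) * φ l k = 0 := fun k =>
    combination_eq_zero hχ fun n => by
      refine Eq.trans ?_ (congrFun (congrFun h1 n) k)
      refine Finset.sum_congr rfl fun j _ => ?_
      rw [Finset.sum_mul]
      exact Finset.sum_congr rfl fun l _ => by ring
  rintro ⟨j, l⟩
  exact combination_eq_zero hφ (c := fun l => g (j, l)) (fun k => h2 k j) l

theorem gauge_field_eq_zero_iff (hχ : LinearIndependent ℝ χ) (r s : Fin n₀ → ℝ → ℝ) :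
    ∑ j, genU (χ j) (r j) + ∑ j, genV (χ j) (s j) = 0 ↔
      ∃ c : Fin n₀ → ℝ, ∀ j, (r j = fun _ => c j) ∧ (s j = fun _ => -c j) := by
  rw [gauge_field_eq]
  constructor
  · intro h
    have h1 : ∀ j x y, r j x + s j y = 0 := fun j x y =>
      combination_eq_zero hχ (c := fun j => r j x + s j y) (fun n =>
        congrFun (congrFun (congrFun (congrFun (congrArg (fun v => v.2.2) h) n) x) y) 0) j
    refine ⟨fun j => r j 0, fun j => ⟨funext fun x => ?_, funext fun y => ?_⟩⟩
    · linarith [h1 j x 0, h1 j 0 0]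
    · linarith [h1 j 0 y]
  · rintro ⟨c, hc⟩
    refine Prod.ext rfl (Prod.ext rfl ?_)
    funext n x y u
    simp [hc]

/-! ### Commutators of linear fields and conformal invariance -/

lemma du_lin (a : ℕ → ℝ) (k : ℕ) : du k (fun _ _ u => lin a u) = fun _ _ _ => a k := by
  funext x y u
  simp [du, map_add]

lemma cutAction_zero (L : ℕ) (v : VectorField) : cutAction L v 0 = 0 := by
  funext x y u
  simp [cutAction, dx, dy, du]

lemma cutAction_linearField (L : ℕ) (A : ℕ → ℕ → ℝ) (a : ℕ → ℝ) (x y : ℝ) (u : ℕ →₀ ℝ) :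
    cutAction L (linearField A) (fun _ _ u => lin a u) x y u
      = ∑ k ∈ Finset.range L, lin (A k) u * a k := by
  simp [cutAction, du_lin, linearField, VectorField.xi, VectorField.eta, dx, dy]

/-- The linear symmetries are closed under commutators. -/
theorem isSymmetry_of_isLieBracket
    (hH : IsSemiBandRows M N p₁ p₂ H) (hK : IsSemiBandColumns M' N' q₁ q₂ K)
    (hrows : Function.Injective H) (hrow_ne : ∀ i, H i ≠ 0)
    (hHK : ∀ j, ∃ i, ∑ᶠ l : ℕ, H i l * K l j ≠ 0)
    {v w c : VectorField} (hv : IsSymmetry H K v)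
    (hv' : IsLinearField v) (hw : IsSymmetry H K w) (hw' : IsLinearField w)
    (hc : IsLieBracket v w c) : IsSymmetry H K c ∧ IsLinearField c := by
  obtain ⟨A, rfl⟩ := isLinearField_iff.1 hv'
  obtain ⟨B, rfl⟩ := isLinearField_iff.1 hw'
  rw [isSymmetry_linearField_iff hH hK hrows hrow_ne hHK] at hv hw
  -- The bracket of the linear fields of A and B has matrix BA - AB; these are the rows of its
  -- truncations, and `G` collects the limits of their entries.
  let D : ℕ → ℕ → (ℕ →₀ ℝ) →ₗ[ℝ] ℝ := fun L n =>
    ∑ k ∈ Finset.range L, (B n k • lin (A k) - A n k • lin (B k))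
  have hD : ∀ n x y u, Tendsto (fun L => D L n u) atTop (𝓝 (c.phi n x y u)) := by
    intro n x y u
    refine ((hc x y u).2.2 n).congr fun L => ?_
    rw [show VectorField.phi (linearField B) n = fun _ _ u => lin (B n) u from rfl,
      show VectorField.phi (linearField A) n = fun _ _ u => lin (A n) u from rfl,
      cutAction_linearField, cutAction_linearField, ← Finset.sum_sub_distrib]
    simp only [D, LinearMap.sum_apply, LinearMap.sub_apply, LinearMap.smul_apply, smul_eq_mul]
    exact Finset.sum_congr rfl fun k _ => by ring
  let G : ℕ → ℕ → ℝ := fun n l => c.phi n 0 0 (Finsupp.single l 1)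
  have hG : ∀ n l, Tendsto (fun L => ∑ k ∈ Finset.range L, (B n k * A k l - A n k * B k l)) atTop
      (𝓝 (G n l)) := by
    intro n l
    refine (hD n 0 0 (Finsupp.single l 1)).congr fun L => ?_
    simp [D]
  have hDG : ∀ n u, Tendsto (fun L => D L n u) atTop (𝓝 (lin (G n) u)) := by
    intro n u
    induction u using Finsupp.induction_linear with
    | zero => simp
    | add u w hu hw =>
      simp only [map_add]
      exact hu.add hw
    | single l t =>
      rw [lin_single]
      refine ((hG n l).const_mul t).congr fun L => ?_
      simp only [D, LinearMap.sum_apply, LinearMap.sub_apply, LinearMap.smul_apply, smul_eq_mul,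
        lin_single, Finset.mul_sum]
      exact Finset.sum_congr rfl fun k _ => by ring
  have hcG : c = linearField G := by
    refine Prod.ext ?_ (Prod.ext ?_ ?_)
    · funext x y u
      refine tendsto_nhds_unique ((hc x y u).1.congr fun L => ?_) (tendsto_const_nhds (x := 0))
      rw [show VectorField.xi (linearField B) = 0 from rfl,
        show VectorField.xi (linearField A) = 0 from rfl, cutAction_zero, cutAction_zero]
      simp
    · funext x y u
      refine tendsto_nhds_unique ((hc x y u).2.1.congr fun L => ?_) (tendsto_const_nhds (x := 0))
      rw [show VectorField.eta (linearField B) = 0 from rfl,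
        show VectorField.eta (linearField A) = 0 from rfl, cutAction_zero, cutAction_zero]
      simp
    · funext n x y u
      exact tendsto_nhds_unique (hD n x y u) (hDG n u)
  rw [hcG]
  refine ⟨(isSymmetry_linearField_iff hH hK hrows hrow_ne hHK G).2 ⟨fun m l => ?_, fun m n => ?_⟩,
    isLinearField_iff.2 ⟨G, rfl⟩⟩
  · obtain ⟨R, hR⟩ := hH.exists_rowBound
    simp only [finsum_mul_eq_sum_range (hR m)] at hv hw ⊢
    -- Row m of H is finite, so it can be applied before the limit, where HA = HB = 0 makes every
    -- truncation vanish.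
    refine tendsto_nhds_unique (tendsto_finsetSum _ fun n _ => (hG n l).const_mul (H m n))
      (tendsto_const_nhds.congr fun L => ?_)
    simp only [Finset.mul_sum]
    rw [Finset.sum_comm]
    symm
    refine Finset.sum_eq_zero fun k _ => ?_
    have e1 := hv.1 m k
    have e2 := hw.1 m k
    rw [finsum_mul_eq_sum_range (hR m)] at e1 e2
    simp only [mul_sub, ← mul_assoc, Finset.sum_sub_distrib, ← Finset.sum_mul, e1, e2, zero_mul,
      sub_zero]
  · obtain ⟨T, hT⟩ := IsSemiBandRows.exists_rowBound hK
    rw [finsum_mul_eq_sum_range (hT m)]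
    refine tendsto_nhds_unique (tendsto_finsetSum _ fun l _ => (hG n l).const_mul (K l m))
      (tendsto_const_nhds.congr fun L => ?_)
    simp only [Finset.mul_sum]
    rw [Finset.sum_comm]
    symm
    refine Finset.sum_eq_zero fun k _ => ?_
    have e1 := hv.2 m k
    have e2 := hw.2 m k
    rw [finsum_mul_eq_sum_range (hT m)] at e1 e2
    simp only [mul_sub, mul_left_comm (K _ m), Finset.sum_sub_distrib, ← Finset.mul_sum, e1, e2,
      mul_zero, sub_zero]

lemma genZ_eq_linearField (χ φ : ℕ → ℝ) : genZ χ φ = linearField fun n k => χ n * φ k := by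
  refine Prod.ext rfl (Prod.ext rfl ?_)
  funext n x y u
  have : lin (fun k => χ n * φ k) = χ n • lin φ := by
    ext k
    simp
  simp only [genZ, linearField, sum_eq_lin, this, LinearMap.smul_apply, smul_eq_mul]
  exact mul_comm _ _

/-- Both matrices have rank one, so each product of the two collapses to a pairing times a rank one
matrix: (χ'φ'ᵀ)(χφᵀ) = (φ'·χ) χ'φᵀ, and likewise in the other order. -/
theorem isLieBracket_genZ {χ φ χ' φ' : ℕ → ℝ} {g h : ℝ}
    (hg : Tendsto (fun L => ∑ m ∈ Finset.range L, φ' m * χ m) atTop (𝓝 g))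
    (hh : Tendsto (fun L => ∑ m ∈ Finset.range L, φ m * χ' m) atTop (𝓝 h)) :
    IsLieBracket (genZ χ φ) (genZ χ' φ') (g • genZ χ' φ - h • genZ χ φ') := by
  have hphi : ∀ (χ φ : ℕ → ℝ) n, (genZ χ φ).2.2 n = fun _ _ u => lin φ u * χ n := fun χ φ n => by
    simp only [genZ, sum_eq_lin]
  have hcut : ∀ (L : ℕ) (χ φ χ' φ' : ℕ → ℝ) n x y u,
      cutAction L (genZ χ φ) ((genZ χ' φ').2.2 n) x y u
        = (∑ k ∈ Finset.range L, φ' k * χ k) * (lin φ u * χ' n) := by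
    intro L χ φ χ' φ' n x y u
    have : (genZ χ' φ').2.2 n = fun _ _ u => lin (fun k => χ' n * φ' k) u := by
      rw [genZ_eq_linearField]; rfl
    rw [this, genZ_eq_linearField χ φ, cutAction_linearField, Finset.sum_mul]
    refine Finset.sum_congr rfl fun k _ => ?_
    have : lin (fun l => χ k * φ l) = χ k • lin φ := by
      ext k
      simp
    rw [this, LinearMap.smul_apply, smul_eq_mul]
    ring
  intro x y u
  refine ⟨?_, ?_, fun n => ?_⟩
  · refine Tendsto.congr (f₁ := fun _ => 0) (fun L => ?_) ?_
    · rw [show VectorField.xi (genZ χ φ) = 0 from rfl,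
        show VectorField.xi (genZ χ' φ') = 0 from rfl, cutAction_zero, cutAction_zero]
      simp
    · simp [genZ, VectorField.xi]
  · refine Tendsto.congr (f₁ := fun _ => 0) (fun L => ?_) ?_
    · rw [show VectorField.eta (genZ χ φ) = 0 from rfl,
        show VectorField.eta (genZ χ' φ') = 0 from rfl, cutAction_zero, cutAction_zero]
      simp
    · simp [genZ, VectorField.eta]
  · simp only [VectorField.phi, hcut]
    simp only [Prod.snd_sub, Prod.smul_snd, Pi.sub_apply, Pi.smul_apply,
      hphi, smul_eq_mul]
    exact (hg.mul_const _).sub (hh.mul_const _)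

theorem conformallyInvariant_iff
    (hH : IsSemiBandRows M N p₁ p₂ H) (hK : IsSemiBandColumns M' N' q₁ q₂ K)
    (hrows : Function.Injective H) (hrow_ne : ∀ i, H i ≠ 0)
    (hHK : ∀ j, ∃ i, ∑ᶠ l : ℕ, H i l * K l j ≠ 0) :
    ConformallyInvariant H K ↔ ∃ b : ℕ → ℝ, ∀ i, ∑ᶠ k, H i k * b k = 1 := by
  constructor
  · intro h
    -- The dilation ξ = x, η = 0 suffices: there Hα = -(1,1,…), so -α at the origin solves Hb =
    -- (1,1,…).
    obtain ⟨v, hv, hxi, heta⟩ := h (fun x => x) (fun _ => 0) contDiff_id contDiff_const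
    obtain ⟨ξ, η, α, A, -, -, -, rfl, -, hα, -⟩ :=
      (hH.isSymmetry_iff hK hrows hrow_ne hHK v).1 hv
    have h1 : ξ = fun x => x := funext fun x => congrFun (congrFun (congrFun hxi x) 0) 0
    have h2 : η = fun _ => 0 := funext fun y => congrFun (congrFun (congrFun heta 0) y) 0
    refine ⟨fun k => -1 * α k 0 0, fun i => ?_⟩
    rw [finsum_mul_const_mul hH, hα, h1, h2]
    simp
  · rintro ⟨b, hb⟩ ξ η hξ hη
    obtain ⟨χ, hχ, hχspan⟩ := hH.exists_basis
    obtain ⟨φ, hφ, hφspan⟩ := IsSemiBandRows.exists_basis hK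
    refine ⟨_, (isSymmetry_iff_conformal hH hK hrows hrow_ne hHK hχ hχspan hφspan hb _).2
      ⟨ξ, η, 0, 0, 0, hξ, hη, fun _ => contDiff_const, fun _ => contDiff_const, rfl⟩, ?_, ?_⟩
    · rw [conformal_field_eq]
    · rw [conformal_field_eq]

end Basis

end Classification

end Toda

end

/-! ### The main theorem -/

theorem theorem3 (M N M' N' : ℕ) (p₁ p₂ q₁ q₂ : ℤ) (H K : ℕ → ℕ → ℝ)
    (hH : Toda.IsSemiBandRows M N p₁ p₂ H)
    (hK : Toda.IsSemiBandColumns M' N' q₁ q₂ K)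
    (hrows : Function.Injective H)
    (hrow_ne : ∀ i, H i ≠ 0)
    (hHK : ∀ j, ∃ i, ∑ᶠ l : ℕ, H i l * K l j ≠ 0) :
    -- conformal invariance holds exactly when `(1, …, 1)` is in the image of the corner block
    (Toda.ConformallyInvariant H K ↔
      (fun _ => (1 : ℝ)) ∈ LinearMap.range (Toda.corner H M N).mulVecLin) ∧
    ((fun _ => (1 : ℝ)) ∈ LinearMap.range (Toda.corner H M N).mulVecLin →
      ∃ b, Toda.IsRightSolution M N p₁ p₂ H 1 b) ∧
    ∃ (χ : Fin (Toda.gaugeNumber M N p₂ H).toNat → ℕ → ℝ)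
      (φ : Fin (Toda.leftNumber M' N' q₂ K).toNat → ℕ → ℝ),
      -- bases of the solution spaces of `H B = 0` and `φ K = 0`
      (LinearIndependent ℝ χ ∧
        ∀ B, Toda.IsRightSolution M N p₁ p₂ H 0 B ↔ B ∈ Submodule.span ℝ (Set.range χ)) ∧
      (LinearIndependent ℝ φ ∧
        ∀ f, Toda.IsLeftSolution M' N' q₁ q₂ K f ↔ f ∈ Submodule.span ℝ (Set.range φ)) ∧
      -- all symmetries in the conformally invariant case
      (∀ b, Toda.IsRightSolution M N p₁ p₂ H 1 b → ∀ v : Toda.VectorField,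
        (Toda.IsSymmetry H K v ↔
          ∃ (ξ η : ℝ → ℝ) (r s : Fin (Toda.gaugeNumber M N p₂ H).toNat → ℝ → ℝ)
            (q : Fin (Toda.gaugeNumber M N p₂ H).toNat →
              Fin (Toda.leftNumber M' N' q₂ K).toNat → ℝ),
            ContDiff ℝ ∞ ξ ∧ ContDiff ℝ ∞ η ∧
            (∀ j, ContDiff ℝ ∞ (r j)) ∧ (∀ j, ContDiff ℝ ∞ (s j)) ∧
            v = Toda.genX b ξ + Toda.genY b η
              + ∑ j, Toda.genU (χ j) (r j) + ∑ j, Toda.genV (χ j) (s j)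
              + ∑ j, ∑ l, q j l • Toda.genZ (χ j) (φ l))) ∧
      -- all symmetries otherwise: reparametrizations reduce to Poincare transformations
      ((fun _ => (1 : ℝ)) ∉ LinearMap.range (Toda.corner H M N).mulVecLin →
        ∀ v : Toda.VectorField,
        (Toda.IsSymmetry H K v ↔
          ∃ (a₁ a₂ c : ℝ) (r s : Fin (Toda.gaugeNumber M N p₂ H).toNat → ℝ → ℝ)
            (q : Fin (Toda.gaugeNumber M N p₂ H).toNat →
              Fin (Toda.leftNumber M' N' q₂ K).toNat → ℝ),
            (∀ j, ContDiff ℝ ∞ (r j)) ∧ (∀ j, ContDiff ℝ ∞ (s j)) ∧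
            v = a₁ • Toda.genP₁ + a₂ • Toda.genP₂ + c • Toda.genL
              + ∑ j, Toda.genU (χ j) (r j) + ∑ j, Toda.genV (χ j) (s j)
              + ∑ j, ∑ l, q j l • Toda.genZ (χ j) (φ l))) ∧
      -- the `2 n₀` functions in the gauge generators are independent, up to constants that can be
      -- moved between `r j` and `s j`
      (∀ r s : Fin (Toda.gaugeNumber M N p₂ H).toNat → ℝ → ℝ,
        (∑ j, Toda.genU (χ j) (r j) + ∑ j, Toda.genV (χ j) (s j) = 0 ↔
          ∃ c : Fin (Toda.gaugeNumber M N p₂ H).toNat → ℝ,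
            ∀ j, (r j = fun _ => c j) ∧ (s j = fun _ => -c j))) ∧
      -- the `Z`-type symmetries form a space of dimension `n₀ m₀` with basis the `Z_{jl}`
      LinearIndependent ℝ (fun t : Fin (Toda.gaugeNumber M N p₂ H).toNat ×
          Fin (Toda.leftNumber M' N' q₂ K).toNat => Toda.genZ (χ t.1) (φ t.2)) ∧
      (∀ v : Toda.VectorField, Toda.IsSymmetry H K v ∧ Toda.IsLinearField v ↔
        v ∈ Submodule.span ℝ (Set.range fun t : Fin (Toda.gaugeNumber M N p₂ H).toNat ×
          Fin (Toda.leftNumber M' N' q₂ K).toNat => Toda.genZ (χ t.1) (φ t.2))) ∧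
      -- this space is closed under commutators (whenever their series converge) ...
      (∀ v w c : Toda.VectorField,
        Toda.IsSymmetry H K v → Toda.IsLinearField v →
        Toda.IsSymmetry H K w → Toda.IsLinearField w →
        Toda.IsLieBracket v w c → Toda.IsSymmetry H K c ∧ Toda.IsLinearField c) ∧
      -- ... with the structure constants given by the pairings of the `φ l` and the `χ j`
      (∀ (a c : Fin (Toda.gaugeNumber M N p₂ H).toNat)
        (b d : Fin (Toda.leftNumber M' N' q₂ K).toNat) (g h : ℝ),
        Filter.Tendsto (fun L => ∑ m ∈ Finset.range L, φ d m * χ a m) Filter.atTop (nhds g) →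
        Filter.Tendsto (fun L => ∑ m ∈ Finset.range L, φ b m * χ c m) Filter.atTop (nhds h) →
        Toda.IsLieBracket (Toda.genZ (χ a) (φ b)) (Toda.genZ (χ c) (φ d))
          (g • Toda.genZ (χ c) (φ b) - h • Toda.genZ (χ a) (φ d))) := by
  have hK' : Toda.IsSemiBandRows N' M' q₁ q₂ (fun j i => K i j) := hK
  obtain ⟨χ, hχ, hχspan⟩ := hH.exists_basis
  -- The left kernel of K is the kernel of its transpose, and `leftNumber` unfolds to `gaugeNumber`
  -- of the transpose.
  obtain ⟨φ, hφ, hφspan⟩ : ∃ φ : Fin (Toda.leftNumber M' N' q₂ K).toNat → ℕ → ℝ,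
      LinearIndependent ℝ φ ∧ Submodule.span ℝ (Set.range φ) = Toda.kernel hK' :=
    hK'.exists_basis
  rw [hH.one_mem_range_iff]
  refine ⟨Toda.conformallyInvariant_iff hH hK hrows hrow_ne hHK, ?_, χ, φ,
    ⟨hχ, fun B => ?_⟩, ⟨hφ, fun f => ?_⟩, fun b hb v => ?_, fun hb v => ?_,
    Toda.gauge_field_eq_zero_iff hχ, Toda.linearIndependent_genZ hχ hφ,
    Toda.isSymmetry_and_isLinearField_iff hH hK hrows hrow_ne hHK hχ hχspan hφspan,
    fun v w c => Toda.isSymmetry_of_isLieBracket hH hK hrows hrow_ne hHK,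
    fun a c b d g h => Toda.isLieBracket_genZ⟩
  · rintro ⟨b, hb⟩
    exact ⟨b, hH.isRightSolution_iff.2 hb⟩
  · rw [hχspan]
    exact hH.isRightSolution_iff
  · rw [hφspan]
    exact hK'.isRightSolution_iff (c := 0)
  · exact Toda.isSymmetry_iff_conformal hH hK hrows hrow_ne hHK hχ hχspan hφspan
      (hH.isRightSolution_iff.1 hb) v
  · exact Toda.isSymmetry_iff_poincare hH hK hrows hrow_ne hHK hχ hχspan hφspan hb v
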